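/- Let $n\in\mathbb N$, $n\ge 1$; all functions are complex-valued. Let $p_0$ be a measurable function on $(0,1)$, nonzero almost everywhere, with $p_0,\,1/p_0\in L(0,1)$, and let $b$ be a measurable function with $b^2=p_0$. For a measurable weight $w$ let $L_{2,w}$ be the space of measurable $f$ with $wf\in L_2(0,1)$ (functions equal almost everywhere being identified). For $k\ge 0$ let $W_{2,b}^k$ be the set of $g$ with $g,g',\dots,g^{(k-1)}\in AC[0,1]$ and $g^{(k)}\in L_{2,b}$; let $\mathring W_{2,b}^k$ be the set of those $g\in W^k_{2,b}$ with $g^{(j)}(0)=g^{(j)}(1)=0$ for $0\le j\le k-1$; and let $W_{2,1/b}^{-k}$ be the set of functionals $f$ on $\mathring W_{2,b}^k$ of the form $$(f,\varphi)=(-1)^k\int_0^1\sigma(x)\varphi^{(k)}(x)\,dx,\qquad \sigma\in L_{2,1/b};$$ in this case $\sigma$ is called a $k$-th antiderivative of $f$, written $\sigma^{(k)}=f$. For $f\in W_{2,1/b}^{-k}$, $y\in W_{2,b}^k$ and $m\ge 0$ put $(fy,\varphi)=(f,\varphi y)$ and $(f^{(m)},\varphi)=(-1)^m(f,\varphi^{(m)})$;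 a function $z\in L(0,1)$ acts by $(z,\varphi)=\int_0^1 z\varphi\,dx$, and $p_0y^{(n)}$ is the pointwise product. Let $p_k\in W_{2,1/b}^{-k}$ $(1\le k\le n)$ and $q_k\in W_{2,1/b}^{-k}$ $(0\le k\le n-1)$, and for $y\in W_{2,b}^n$ define a functional on $\mathring W_{2,b}^n$ by $$\ell_{2n}y=\sum_{k=0}^n\bigl(p_ky^{(n-k)}\bigr)^{(n-k)}+i\sum_{k=0}^{n-1}\Bigl(\bigl(q_ky^{(n-k-1)}\bigr)^{(n-k)}+\bigl(q_ky^{(n-k)}\bigr)^{(n-k-1)}\Bigr).$$ Then there are a measurable kernel $K(x,t)$, $0<t<x<1$, a function $a\in L_{2,1/b}$ and functions $u_0,\dots,u_{n-1}\in L_{2,1/b}$ such that $$|K(x,t)|\le a(x)+a(t),\qquad 0<t<x<1,$$ the operator $$Bf(x)=b^2(x)f(x)+\int_0^xK(x,t)f(t)\,dt$$ is well defined on $L_{2,b}$ and maps $L_{2,b}$ bijectively onto $L_{2,1/b}$, and, with $$Cy(x)=\sum_{\nu=0}^{n-1}y^{(\nu)}(0)\,u_\nu(x),$$ one has, for every $y\in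 W_{2,b}^n$, $$\ell_{2n}y=\frac{d^n}{dx^n}\bigl(By^{(n)}+Cy\bigr)$$ as functionals on $\mathring W_{2,b}^n$. Moreover, for every choice of antiderivatives $P_k,Q_{k-1}\in L_{2,1/b}$ with $P_k^{(k)}=p_k$ and $Q_{k-1}^{(k-1)}=q_{k-1}$, $1\le k\le n$, the kernel is given for almost all $(x,t)$ with $0<t<x<1$ by $$K(x,t)=\sum_{k=1}^n\Biggl(\frac{(x-t)^{k-1}}{(k-1)!}\Bigl(P_k(x)+iQ_{k-1}(x)+(-1)^k\bigl(P_k(t)-iQ_{k-1}(t)\bigr)\Bigr)$$ $$\qquad+\sum_{\nu=1}^{k-1}(-1)^\nu\int_t^x\frac{(x-\tau)^{\nu-1}}{(\nu-1)!}\Bigl(\tbinom{k}{\nu}P_k(\tau)+i\Bigl(\tbinom{k-1}{\nu}-\tbinom{k-1}{\nu-1}\Bigr)Q_{k-1}(\tau)\Bigr)\frac{(\tau-t)^{k-1-\nu}}{(k-1-\nu)!}\,d\tau\Biggr).$$ -/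

import Mathlib

open MeasureTheory Set

noncomputable section

namespace SingExpr

/-- Lebesgue measure on the interval `(0,1)`. -/
def mu : Measure ℝ := volume.restrict (Ioo (0 : ℝ) 1)

/-- `f ∈ L_{2,w}`: `f` is measurable on `(0,1)` and `w f ∈ L_2(0,1)`. -/
def MemWL2 (w f : ℝ → ℂ) : Prop :=
  AEStronglyMeasurable f mu ∧ MemLp (fun x => w x * f x) 2 mu

/-- The reciprocal weight `1/b`. -/
def recip (b : ℝ → ℂ) : ℝ → ℂ := fun x => 1 / b x

/-- The `j`-th derivative of a function on `[0,1]` (one-sided at the end points). -/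
def der (j : ℕ) (g : ℝ → ℂ) : ℝ → ℂ := iteratedDerivWithin j g (Icc (0 : ℝ) 1)

/-- `g ∈ W_{2,b}^k`: the functions `g, g', …, g^{(k-1)}` are absolutely continuous on `[0,1]`
and `g^{(k)} ∈ L_{2,b}`. -/
def MemW (b : ℝ → ℂ) (k : ℕ) (g : ℝ → ℂ) : Prop :=
  (∀ j < k, AbsolutelyContinuousOnInterval (der j g) 0 1) ∧ MemWL2 b (der k g)

/-- The test functions of order `k`: those `g ∈ W_{2,b}^k` with
`g^{(j)}(0) = g^{(j)}(1) = 0` for `j < k`. -/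
def MemW0 (b : ℝ → ℂ) (k : ℕ) (g : ℝ → ℂ) : Prop :=
  MemW b k g ∧ ∀ j < k, der j g 0 = 0 ∧ der j g 1 = 0

/-- Functionals on test functions. A generalized function of order `k` is only ever evaluated on
test functions of order `k`; its values elsewhere carry no information. -/
abbrev Functional : Type := (ℝ → ℂ) → ℂ

/-- The functional `φ ↦ ∫₀¹ σ φ` defined by a function `σ`. -/
def reg (σ : ℝ → ℂ) : Functional := fun φ => ∫ x in (0 : ℝ)..1, σ x * φ x

/-- The `m`-th generalized derivative, `(f^{(m)}, φ) = (-1)^m (f, φ^{(m)})`. -/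
def gDer (m : ℕ) (f : Functional) : Functional := fun φ => (-1) ^ m * f (der m φ)

/-- The product of a functional and a function, `(f y, φ) = (f, φ y)`. -/
def gMul (f : Functional) (y : ℝ → ℂ) : Functional := fun φ => f (fun x => φ x * y x)

/-- `σ ∈ L_{2,1/b}` is a `k`-th antiderivative of the functional `f`: as functionals on the test
functions of order `k`, `f = σ^{(k)}`. -/
def IsAntideriv (b : ℝ → ℂ) (k : ℕ) (σ : ℝ → ℂ) (f : Functional) : Prop :=
  MemWL2 (recip b) σ ∧ ∀ φ, MemW0 b k φ → f φ = gDer k (reg σ) φ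

/-- `f ∈ W_{2,1/b}^{-k}`. -/
def MemNegW (b : ℝ → ℂ) (k : ℕ) (f : Functional) : Prop := ∃ σ, IsAntideriv b k σ f

/-- The singular differential expression of order `2n` applied to `y`, as a functional on the test
functions of order `n`. The leading coefficient `p₀` is a function and `p₀ y^{(n)}` is the
pointwise product. -/
def ell (n : ℕ) (p₀ : ℝ → ℂ) (p q : ℕ → Functional) (y : ℝ → ℂ) : Functional := fun φ =>
  gDer n (reg (fun x => p₀ x * der n y x)) φ
    + ∑ k ∈ Finset.Icc 1 n, gDer (n - k) (gMul (p k) (der (n - k) y)) φ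
    + Complex.I * ∑ k ∈ Finset.range n,
        (gDer (n - k) (gMul (q k) (der (n - k - 1) y)) φ
          + gDer (n - k - 1) (gMul (q k) (der (n - k) y)) φ)

/-- `(Bf)(x) = b(x)² f(x) + ∫₀ˣ K(x,t) f(t) dt`. -/
def opB (b : ℝ → ℂ) (K : ℝ → ℝ → ℂ) (f : ℝ → ℂ) : ℝ → ℂ := fun x =>
  b x ^ 2 * f x + ∫ t in (0 : ℝ)..x, K x t * f t

/-- `(Cy)(x) = ∑_{ν<n} y^{(ν)}(0) u_ν(x)`. -/
def opC (n : ℕ) (u : ℕ → ℝ → ℂ) (y : ℝ → ℂ) : ℝ → ℂ := fun x =>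
  ∑ ν ∈ Finset.range n, der ν y 0 * u ν x

/-- `T` induces a well-defined bijection from the space `X` onto the space `Y`, functions that
agree almost everywhere on `(0,1)` being identified. -/
def BijectiveModAE (T : (ℝ → ℂ) → (ℝ → ℂ)) (X Y : (ℝ → ℂ) → Prop) : Prop :=
  (∀ f, X f → Y (T f)) ∧
  (∀ f g, X f → X g → f =ᵐ[mu] g → T f =ᵐ[mu] T g) ∧
  (∀ f g, X f → X g → T f =ᵐ[mu] T g → f =ᵐ[mu] g) ∧
  (∀ h, Y h → ∃ f, X f ∧ T f =ᵐ[mu] h)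

/-- The triangle `0 < t < x < 1` of points `(x,t)`. -/
def triangle : Set (ℝ × ℝ) := {z | 0 < z.2 ∧ z.2 < z.1 ∧ z.1 < 1}

/-- The explicit kernel built from the antiderivatives `P_k` (`1 ≤ k ≤ n`) and `Q_k` (`k < n`). -/
def kernel (n : ℕ) (P Q : ℕ → ℝ → ℂ) (x t : ℝ) : ℂ :=
  ∑ k ∈ Finset.Icc 1 n,
    (((x : ℂ) - t) ^ (k - 1) / ((k - 1).factorial : ℂ)
        * (P k x + Complex.I * Q (k - 1) x
            + (-1) ^ k * (P k t - Complex.I * Q (k - 1) t))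
      + ∑ ν ∈ Finset.Icc 1 (k - 1), (-1) ^ ν *
          ∫ τ in t..x,
            ((x : ℂ) - τ) ^ (ν - 1) / ((ν - 1).factorial : ℂ)
              * ((k.choose ν : ℂ) * P k τ
                  + Complex.I * (((k - 1).choose ν : ℂ) - ((k - 1).choose (ν - 1) : ℂ))
                      * Q (k - 1) τ)
              * (((τ : ℂ) - t) ^ (k - 1 - ν) / ((k - 1 - ν).factorial : ℂ)))

end SingExpr

end

noncomputable section

namespace SingExpr

/-! ### Integrals over the unit interval -/

/-! Write J for integration from 0. In (ℓy, φ) the k-th antiderivatives turn each lower-order term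
into an integral of σ against the k-th derivative of a product of derivatives of φ and y. Leibniz'
rule splits these into pairings ∫ σ y^{(n-j)} φ^{(n-i)} with i + j ≥ 1 (`ell_eq`). By Taylor's
formula y^{(n-j)} is J^j y^{(n)} plus a polynomial in the initial values of y. Then i integrations
by parts, free of boundary terms because φ vanishes to order n at both ends, raise φ^{(n-i)} to
φ^{(n)}. What remains is the operator (-1)^i J^i σ J^j applied to y^{(n)}, with an explicit Volterra
kernel by Cauchy's formula for iterated primitives; the polynomials supply the functions u_ν
(`represents_pairing`). The kernel is of size |σ(x)| if i = 0, |σ(t)| if j = 0, and at most the L₁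
norm of σ otherwise, which yields the bound a(x) + a(t). Collecting the pairings gives the stated
formula (`lowerSum_eq_kernel`).

Bijectivity of B: with F = bf, the function Bf / b is F plus the integral of K(x,t) / (b(x) b(t))
against F. This kernel is Hilbert–Schmidt, since a/b and 1/b are square integrable. Conjugation with
e^{-mx} multiplies it by e^{-m(x-t)}. As it lives on t < x, its L₂ norm tends to 0 as m grows, so
for some m the operator is the identity plus a strict contraction (`bijective_opB`).

The formula holds for every choice of antiderivatives because the functional does not depend on the
choice and determines its kernel. If D represents the zero functional, D is orthogonal to all
products g(x) f(t) with g orthogonal to polynomials of degree < n. For f supported in t > s, any g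
on x ≥ s can be corrected on x < s to satisfy the moment conditions without changing the integral,
since D vanishes where x < s < t. Hence D = 0 for t > s, and s tends to 0
(`Represents.cut_ae_eq_zero`). -/

instance : IsFiniteMeasure mu := by unfold mu; infer_instance

lemma ae_mu_mem : ∀ᵐ x ∂mu, x ∈ Ioo (0 : ℝ) 1 := ae_restrict_mem measurableSet_Ioo

lemma ae_mu_of_ae {p : ℝ → Prop} (h : ∀ᵐ x, p x) : ∀ᵐ x ∂mu, p x := ae_restrict_of_ae h

lemma intervalIntegral_eq_integral_mu {x y : ℝ} (hx : 0 ≤ x) (hxy : x ≤ y) (hy : y ≤ 1)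
    (F : ℝ → ℂ) : ∫ t in x..y, F t = ∫ t, (Ioo x y).indicator F t ∂mu := by
  rw [intervalIntegral.integral_of_le hxy, integral_Ioc_eq_integral_Ioo,
    integral_indicator measurableSet_Ioo, mu, Measure.restrict_restrict measurableSet_Ioo,
    inter_eq_self_of_subset_left (Ioo_subset_Ioo hx hy)]

lemma intervalIntegral_zero_one (F : ℝ → ℂ) : ∫ t in (0 : ℝ)..1, F t = ∫ t, F t ∂mu := by
  rw [intervalIntegral.integral_of_le zero_le_one, integral_Ioc_eq_integral_Ioo, mu]

lemma intervalIntegral_zero_left {x : ℝ} (hx : x ∈ Icc (0 : ℝ) 1) (F : ℝ → ℂ) :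
    ∫ t in (0 : ℝ)..x, F t = ∫ t, (Iio x).indicator F t ∂mu := by
  rw [intervalIntegral_eq_integral_mu le_rfl hx.1 hx.2]
  refine integral_congr_ae ?_
  filter_upwards [ae_mu_mem] with t ht
  simp only [indicator, mem_Ioo, mem_Iio, ht.1, true_and]

lemma intervalIntegrable_iff_mu {F : ℝ → ℂ} :
    IntervalIntegrable F volume 0 1 ↔ Integrable F mu := by
  rw [intervalIntegrable_iff_integrableOn_Ioo_of_le zero_le_one, mu, IntegrableOn]

lemma intervalIntegrable_of_mem {F : ℝ → ℂ} (hF : Integrable F mu) {x y : ℝ}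
    (hx : x ∈ Icc (0 : ℝ) 1) (hy : y ∈ Icc (0 : ℝ) 1) : IntervalIntegrable F volume x y := by
  refine (intervalIntegrable_iff_mu.2 hF).mono_set ?_
  rw [uIcc_of_le zero_le_one]
  exact uIcc_subset_Icc hx hy

lemma intervalIntegral_congr_ae_mu {F G : ℝ → ℂ} (h : F =ᵐ[mu] G) {x y : ℝ}
    (hx : x ∈ Icc (0 : ℝ) 1) (hy : y ∈ Icc (0 : ℝ) 1) :
    ∫ t in x..y, F t = ∫ t in x..y, G t := by
  have key : ∀ x y : ℝ, 0 ≤ x → x ≤ y → y ≤ 1 → ∫ t in x..y, F t = ∫ t in x..y, G t := by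
    intro x y h0 hxy h1
    rw [intervalIntegral_eq_integral_mu h0 hxy h1, intervalIntegral_eq_integral_mu h0 hxy h1]
    refine integral_congr_ae ?_
    filter_upwards [h] with t ht
    by_cases hm : t ∈ Ioo x y <;> simp [hm, ht]
  rcases le_total x y with hxy | hxy
  · exact key x y hx.1 hxy hy.2
  · rw [intervalIntegral.integral_symm, key y x hy.1 hxy hx.2, ← intervalIntegral.integral_symm]

lemma aestronglyMeasurable_of_continuousOn {F : ℝ → ℂ} (hF : ContinuousOn F (Icc 0 1)) :
    AEStronglyMeasurable F mu :=
  (hF.mono Ioo_subset_Icc_self).aestronglyMeasurable measurableSet_Ioo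

lemma exists_bound_of_continuousOn {F : ℝ → ℂ} (hF : ContinuousOn F (Icc 0 1)) :
    ∃ C : ℝ, ∀ᵐ x ∂mu, ‖F x‖ ≤ C := by
  obtain ⟨C, hC⟩ := isCompact_Icc.exists_bound_of_continuousOn hF
  exact ⟨C, by filter_upwards [ae_mu_mem] with x hx using hC x (Ioo_subset_Icc_self hx)⟩

lemma integrable_of_continuousOn {F : ℝ → ℂ} (hF : ContinuousOn F (Icc 0 1)) :
    Integrable F mu := by
  obtain ⟨C, hC⟩ := exists_bound_of_continuousOn hF
  exact Integrable.of_bound (aestronglyMeasurable_of_continuousOn hF) C hC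

lemma integrable_mul_continuousOn {F G : ℝ → ℂ} (hF : Integrable F mu)
    (hG : ContinuousOn G (Icc 0 1)) : Integrable (fun x => F x * G x) mu := by
  obtain ⟨C, hC⟩ := exists_bound_of_continuousOn hG
  exact hF.mul_bdd (c := C) (aestronglyMeasurable_of_continuousOn hG) hC

lemma integrable_continuousOn_mul {F G : ℝ → ℂ} (hF : Integrable F mu)
    (hG : ContinuousOn G (Icc 0 1)) : Integrable (fun x => G x * F x) mu := by
  simpa only [mul_comm] using integrable_mul_continuousOn hF hG

/-! ### Weights and weighted spaces -/

/-- A weight `b` that is nonzero almost everywhere and such that `b` and `1/b` are square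
integrable. -/
structure GoodWeight (b : ℝ → ℂ) : Prop where
  memLp : MemLp b 2 mu
  memLp_recip : MemLp (recip b) 2 mu
  ne_zero : ∀ᵐ x ∂mu, b x ≠ 0

lemma goodWeight_of_sq {p₀ b : ℝ → ℂ} (hp₀ : Integrable p₀ mu) (hne : ∀ᵐ x ∂mu, p₀ x ≠ 0)
    (hinv : Integrable (fun x => 1 / p₀ x) mu) (hbm : AEStronglyMeasurable b mu)
    (hb : ∀ᵐ x ∂mu, b x ^ 2 = p₀ x) : GoodWeight b where
  memLp := by
    rw [memLp_two_iff_integrable_sq_norm hbm]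
    refine hp₀.norm.congr ?_
    filter_upwards [hb] with x hx
    rw [← hx, norm_pow]
  memLp_recip := by
    have hm : AEStronglyMeasurable (recip b) mu := by
      unfold recip
      exact (hbm.aemeasurable.const_div 1).aestronglyMeasurable
    rw [memLp_two_iff_integrable_sq_norm hm]
    refine hinv.norm.congr ?_
    filter_upwards [hb] with x hx
    rw [recip, ← hx, ← norm_pow, one_div, one_div, inv_pow]
  ne_zero := by
    filter_upwards [hb, hne] with x h1 h2 h3
    simp [h3] at h1
    exact h2 h1.symm

lemma recip_recip (b : ℝ → ℂ) : recip (recip b) = b := by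
  funext x; simp [recip]

lemma GoodWeight.recip {b : ℝ → ℂ} (hb : GoodWeight b) : GoodWeight (recip b) where
  memLp := hb.memLp_recip
  memLp_recip := by rw [recip_recip]; exact hb.memLp
  ne_zero := by
    filter_upwards [hb.ne_zero] with x hx
    simp [SingExpr.recip, hx]

lemma MemWL2.add {w f g : ℝ → ℂ} (hf : MemWL2 w f) (hg : MemWL2 w g) :
    MemWL2 w (fun x => f x + g x) :=
  ⟨hf.1.add hg.1, by simpa only [mul_add] using! hf.2.add hg.2⟩

lemma MemWL2.const_mul {w f : ℝ → ℂ} (hf : MemWL2 w f) (c : ℂ) :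
    MemWL2 w (fun x => c * f x) :=
  ⟨hf.1.const_mul c, by simpa only [mul_left_comm] using hf.2.const_mul c⟩

lemma MemWL2.sub {w f g : ℝ → ℂ} (hf : MemWL2 w f) (hg : MemWL2 w g) :
    MemWL2 w (fun x => f x - g x) := by
  simpa only [neg_one_mul, ← sub_eq_add_neg] using hf.add (hg.const_mul (-1))

lemma memWL2_zero (w : ℝ → ℂ) : MemWL2 w (fun _ => 0) :=
  ⟨aestronglyMeasurable_const, by simp⟩

lemma MemWL2.sum {ι : Type*} (s : Finset ι) {w : ℝ → ℂ} {f : ι → ℝ → ℂ}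
    (hf : ∀ i ∈ s, MemWL2 w (f i)) : MemWL2 w (fun x => ∑ i ∈ s, f i x) := by
  classical
  induction s using Finset.induction_on with
  | empty => simpa using memWL2_zero w
  | insert i s hi ih =>
    simp only [Finset.sum_insert hi]
    exact (hf i (Finset.mem_insert_self _ _)).add
      (ih fun j hj => hf j (Finset.mem_insert_of_mem hj))

lemma MemWL2.congr {w f g : ℝ → ℂ} (hf : MemWL2 w f) (h : f =ᵐ[mu] g) : MemWL2 w g :=
  ⟨hf.1.congr h, hf.2.ae_eq (by filter_upwards [h] with x hx; rw [hx])⟩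

lemma MemWL2.of_norm_le {w f g : ℝ → ℂ} (hw : GoodWeight w) (hf : MemWL2 w f)
    (hg : AEStronglyMeasurable g mu) (h : ∀ᵐ x ∂mu, ‖g x‖ ≤ ‖f x‖) : MemWL2 w g :=
  ⟨hg, hf.2.mono (hw.memLp.1.mul hg) (by
    filter_upwards [h] with x hx
    rw [norm_mul, norm_mul]
    gcongr)⟩

lemma memWL2_const {w : ℝ → ℂ} (hw : GoodWeight w) (c : ℂ) : MemWL2 w (fun _ => c) :=
  ⟨aestronglyMeasurable_const, by simpa only [mul_comm] using hw.memLp.const_mul c⟩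

lemma memWL2_of_bounded {w f : ℝ → ℂ} (hw : GoodWeight w) (hf : AEStronglyMeasurable f mu)
    {C : ℝ} (hC : ∀ᵐ x ∂mu, ‖f x‖ ≤ C) : MemWL2 w f := by
  refine MemWL2.of_norm_le hw (memWL2_const hw (C : ℂ)) hf ?_
  filter_upwards [hC] with x hx
  rw [Complex.norm_real]
  exact hx.trans (le_abs_self C)

lemma memWL2_of_continuousOn {w f : ℝ → ℂ} (hw : GoodWeight w)
    (hf : ContinuousOn f (Icc 0 1)) : MemWL2 w f := by
  obtain ⟨C, hC⟩ := exists_bound_of_continuousOn hf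
  exact memWL2_of_bounded hw (aestronglyMeasurable_of_continuousOn hf) hC

lemma MemWL2.mul_bounded {w f g : ℝ → ℂ} (hw : GoodWeight w) (hf : MemWL2 w f)
    (hg : AEStronglyMeasurable g mu) {C : ℝ} (hC : ∀ᵐ x ∂mu, ‖g x‖ ≤ C) :
    MemWL2 w (fun x => f x * g x) := by
  refine MemWL2.of_norm_le hw (hf.const_mul (C : ℂ)) (hf.1.mul hg) ?_
  filter_upwards [hC] with x hx
  rw [norm_mul, norm_mul, Complex.norm_real, mul_comm]
  gcongr
  exact hx.trans (le_abs_self C)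

lemma MemWL2.mul_continuousOn {w f g : ℝ → ℂ} (hw : GoodWeight w) (hf : MemWL2 w f)
    (hg : ContinuousOn g (Icc 0 1)) : MemWL2 w (fun x => f x * g x) := by
  obtain ⟨C, hC⟩ := exists_bound_of_continuousOn hg
  exact hf.mul_bounded hw (aestronglyMeasurable_of_continuousOn hg) hC

lemma MemWL2.norm {w f : ℝ → ℂ} (hw : GoodWeight w) (hf : MemWL2 w f) :
    MemWL2 w (fun x => ((‖f x‖ : ℝ) : ℂ)) :=
  MemWL2.of_norm_le hw hf
    (Complex.continuous_ofReal.comp_aestronglyMeasurable hf.1.norm) (by simp)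

/-- The weights cancel in σ f = (σ / b)(b f), a product of two square integrable functions. This is
the duality between L_{2,1/b} and L_{2,b} behind every pairing below. -/
lemma MemWL2.integrable_mul {b f σ : ℝ → ℂ} (hb : GoodWeight b) (hσ : MemWL2 (recip b) σ)
    (hf : MemWL2 b f) : Integrable (fun x => σ x * f x) mu := by
  refine (hσ.2.integrable_mul hf.2).congr ?_
  filter_upwards [hb.ne_zero] with x hx
  simp only [Pi.mul_apply, recip]
  field_simp

lemma MemWL2.integrable {w f : ℝ → ℂ} (hw : GoodWeight w) (hf : MemWL2 w f) :
    Integrable f mu := by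
  have h := MemWL2.integrable_mul hw (memWL2_const hw.recip 1) hf
  simpa using h

/-! ### The iterated primitive -/

/-- Interchange of the order of integration over the triangle `0 < t < τ < x`. -/
lemma integral_triangle_swap {F G : ℝ → ℂ} {w : ℝ → ℝ → ℂ} (hF : Integrable F mu)
    (hG : Integrable G mu) (hw : Continuous (Function.uncurry w)) {x : ℝ}
    (hx : x ∈ Icc (0 : ℝ) 1) :
    ∫ τ in (0 : ℝ)..x, F τ * ∫ t in (0 : ℝ)..τ, w τ t * G t
      = ∫ t in (0 : ℝ)..x, (∫ τ in t..x, F τ * w τ t) * G t := by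
  -- The integrand is extended by zero to the whole square, so that Fubini applies with fixed limits
  -- of integration.
  set H : ℝ → ℝ → ℂ := fun τ t =>
    ({z : ℝ × ℝ | z.1 < x ∧ z.2 < z.1}).indicator (fun z => F z.1 * G z.2 * w z.1 z.2) (τ, t)
    with hH
  have hint : Integrable (Function.uncurry H) (mu.prod mu) := by
    have h1 : Integrable (fun z : ℝ × ℝ => F z.1 * G z.2 * w z.1 z.2) (mu.prod mu) := by
      obtain ⟨C, hC⟩ := (isCompact_Icc.prod isCompact_Icc :
        IsCompact (Icc (0 : ℝ) 1 ×ˢ Icc (0 : ℝ) 1)).exists_bound_of_continuousOn hw.continuousOn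
      refine (hF.mul_prod hG).mul_bdd (c := C) hw.aestronglyMeasurable ?_
      have h2 : ∀ᵐ z ∂mu.prod mu, z.1 ∈ Ioo (0 : ℝ) 1 :=
        Measure.quasiMeasurePreserving_fst.ae ae_mu_mem
      have h3 : ∀ᵐ z ∂mu.prod mu, z.2 ∈ Ioo (0 : ℝ) 1 :=
        Measure.quasiMeasurePreserving_snd.ae ae_mu_mem
      filter_upwards [h2, h3] with z hz1 hz2
      exact hC z ⟨Ioo_subset_Icc_self hz1, Ioo_subset_Icc_self hz2⟩
    refine h1.indicator ?_
    exact (measurableSet_lt measurable_fst measurable_const).inter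
      (measurableSet_lt measurable_snd measurable_fst)
  have hswap := integral_integral_swap hint
  rw [intervalIntegral_zero_left hx, intervalIntegral_zero_left hx]
  convert! hswap using 1
  · refine integral_congr_ae ?_
    filter_upwards [ae_mu_mem] with τ hτ
    by_cases h : τ < x
    · rw [indicator_of_mem (show τ ∈ Iio x from h),
        intervalIntegral_zero_left (Ioo_subset_Icc_self hτ), ← integral_const_mul]
      refine integral_congr_ae (Filter.Eventually.of_forall fun t => ?_)
      by_cases h' : t < τ
      · simp [H, indicator, h, h']; ring
      · simp [H, indicator, h']
    · rw [indicator_of_notMem (show τ ∉ Iio x from h)]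
      simp [H, indicator, h]
  · refine integral_congr_ae ?_
    filter_upwards [ae_mu_mem] with t ht
    by_cases h : t < x
    · rw [indicator_of_mem (show t ∈ Iio x from h),
        intervalIntegral_eq_integral_mu ht.1.le h.le hx.2, ← integral_mul_const]
      refine integral_congr_ae (Filter.Eventually.of_forall fun τ => ?_)
      by_cases h1 : t < τ <;> by_cases h2 : τ < x
      · simp [H, indicator, h1, h2]; ring
      all_goals simp [H, indicator, h1, h2]
    · rw [indicator_of_notMem (show t ∉ Iio x from h)]
      symm
      refine integral_eq_zero_of_ae (Filter.Eventually.of_forall fun τ => ?_)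
      have : ¬ (τ < x ∧ t < τ) := fun h' => h (h'.2.trans h'.1)
      simp [H, indicator, this]

/-- The `j`-fold iterated primitive of `f` vanishing at `0`. -/
def volt : ℕ → (ℝ → ℂ) → ℝ → ℂ
  | 0, f => f
  | j + 1, f => fun x => ∫ t in (0 : ℝ)..x, ((x : ℂ) - t) ^ j / (j.factorial : ℂ) * f t

lemma integral_sub_pow_div_factorial (j : ℕ) (t x : ℝ) :
    ∫ τ in t..x, ((τ : ℂ) - t) ^ j / (j.factorial : ℂ)
      = ((x : ℂ) - t) ^ (j + 1) / ((j + 1).factorial : ℂ) := by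
  have hd : ∀ τ ∈ uIcc t x, HasDerivAt
      (fun τ : ℝ => ((τ : ℂ) - t) ^ (j + 1) / ((j + 1).factorial : ℂ))
      (((τ : ℂ) - t) ^ j / (j.factorial : ℂ)) τ := by
    intro τ _
    have h1 : HasDerivAt (fun τ : ℝ => ((τ : ℂ) - t)) 1 τ :=
      (Complex.ofRealCLM.hasDerivAt (x := τ)).sub_const _
    refine ((h1.pow (j + 1)).div_const ((j + 1).factorial : ℂ)).congr_deriv ?_
    have : (j.factorial : ℂ) ≠ 0 := by exact_mod_cast j.factorial_ne_zero
    have h2 : ((j : ℂ) + 1) ≠ 0 := by exact_mod_cast j.succ_ne_zero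
    rw [Nat.factorial_succ]
    push_cast
    field_simp
  rw [intervalIntegral.integral_eq_sub_of_hasDerivAt hd]
  · simp
  · apply Continuous.intervalIntegrable
    fun_prop

/-- Cauchy's formula for repeated integration: after the triangle swap, the inner integral of (τ -
t)^j / j! over (t, x) raises the exponent by one. -/
lemma volt_succ {f : ℝ → ℂ} (hf : Integrable f mu) (j : ℕ) {x : ℝ} (hx : x ∈ Icc (0 : ℝ) 1) :
    volt (j + 1) f x = ∫ t in (0 : ℝ)..x, volt j f t := by
  cases j with
  | zero => simp [volt]
  | succ j =>
    have h := integral_triangle_swap (F := fun _ => 1) (G := f)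
      (w := fun τ t => ((τ : ℂ) - t) ^ j / (j.factorial : ℂ)) (integrable_const _) hf
      (by unfold Function.uncurry; fun_prop) hx
    simp only [one_mul, integral_sub_pow_div_factorial] at h
    simp only [volt]
    rw [h]

lemma continuousOn_primitive_mu {f : ℝ → ℂ} (hf : Integrable f mu) :
    ContinuousOn (fun x => ∫ t in (0 : ℝ)..x, f t) (Icc 0 1) := by
  have := intervalIntegral.continuousOn_primitive_interval' (a := 0)
    (intervalIntegrable_iff_mu.2 hf) (by simp)
  rwa [uIcc_of_le zero_le_one] at this

lemma integrable_volt {f : ℝ → ℂ} (hf : Integrable f mu) (j : ℕ) : Integrable (volt j f) mu := by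
  induction j with
  | zero => exact hf
  | succ j ih =>
    exact integrable_of_continuousOn
      ((continuousOn_primitive_mu ih).congr fun x hx => volt_succ hf j hx)

lemma continuousOn_volt_succ {f : ℝ → ℂ} (hf : Integrable f mu) (j : ℕ) :
    ContinuousOn (volt (j + 1) f) (Icc 0 1) :=
  (continuousOn_primitive_mu (integrable_volt hf j)).congr fun _ hx => volt_succ hf j hx

lemma volt_congr {f g : ℝ → ℂ} (h : f =ᵐ[mu] g) (j : ℕ) {x : ℝ} (hx : x ∈ Icc (0 : ℝ) 1) :
    volt (j + 1) f x = volt (j + 1) g x := by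
  refine intervalIntegral_congr_ae_mu ?_ (by simp) hx
  filter_upwards [h] with t ht
  rw [ht]

/-! ### Absolutely continuous complex functions -/

lemma absolutelyContinuous_of_dist_le {f : ℝ → ℂ} {g : ℝ → ℝ}
    (hf : AbsolutelyContinuousOnInterval f 0 1) (h : ∀ x y, dist (g x) (g y) ≤ dist (f x) (f y)) :
    AbsolutelyContinuousOnInterval g 0 1 :=
  squeeze_zero (fun _ => Finset.sum_nonneg fun _ _ => dist_nonneg)
    (fun _ => Finset.sum_le_sum fun _ _ => h _ _) hf

lemma absolutelyContinuous_congr {f g : ℝ → ℂ} (hf : AbsolutelyContinuousOnInterval f 0 1)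
    (h : EqOn f g (Icc 0 1)) : AbsolutelyContinuousOnInterval g 0 1 := by
  rw [absolutelyContinuousOnInterval_iff] at hf ⊢
  intro ε hε
  obtain ⟨δ, hδ, H⟩ := hf ε hε
  refine ⟨δ, hδ, fun E hE hEδ => ?_⟩
  convert H E hE hEδ using 1
  refine Finset.sum_congr rfl fun i hi => ?_
  have h1 := hE.1 i hi
  rw [uIcc_of_le zero_le_one] at h1
  rw [h h1.1, h h1.2]

/-- Real and imaginary parts inherit absolute continuity because their increments are dominated by
those of `f`; each is differentiable almost everywhere, and `f` is recombined from them. -/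
lemma ae_differentiableAt_of_ac {f : ℝ → ℂ} (hf : AbsolutelyContinuousOnInterval f 0 1) :
    ∀ᵐ x ∂mu, DifferentiableAt ℝ f x := by
  have hre := (absolutelyContinuous_of_dist_le (g := fun x => (f x).re) hf (fun x y => by
    rw [Real.dist_eq, Complex.dist_eq, ← Complex.sub_re]
    exact Complex.abs_re_le_norm _)).ae_differentiableAt
  have him := (absolutelyContinuous_of_dist_le (g := fun x => (f x).im) hf (fun x y => by
    rw [Real.dist_eq, Complex.dist_eq, ← Complex.sub_im]
    exact Complex.abs_im_le_norm _)).ae_differentiableAt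
  filter_upwards [ae_mu_of_ae hre, ae_mu_of_ae him, ae_mu_mem] with x h1 h2 hx
  have hx' : x ∈ uIcc (0 : ℝ) 1 := by
    rw [uIcc_of_le zero_le_one]; exact Ioo_subset_Icc_self hx
  have h3 := (Complex.ofRealCLM.differentiableAt.comp x (h1 hx')).add
    ((Complex.ofRealCLM.differentiableAt.comp x (h2 hx')).mul_const Complex.I)
  refine h3.congr_of_eventuallyEq (Filter.Eventually.of_forall fun y => ?_)
  simp [Complex.re_add_im]

lemma absolutelyContinuous_primitive {f : ℝ → ℂ} (hf : Integrable f mu) :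
    AbsolutelyContinuousOnInterval (fun x => ∫ t in (0 : ℝ)..x, f t) 0 1 := by
  have hre : IntervalIntegrable (fun x => (f x).re) volume 0 1 := by
    rw [intervalIntegrable_iff_integrableOn_Ioo_of_le zero_le_one]; exact hf.re
  have him : IntervalIntegrable (fun x => (f x).im) volume 0 1 := by
    rw [intervalIntegrable_iff_integrableOn_Ioo_of_le zero_le_one]; exact hf.im
  have h1 := hre.absolutelyContinuousOnInterval_intervalIntegral (c := 0) (by simp)
  have h2 := him.absolutelyContinuousOnInterval_intervalIntegral (c := 0) (by simp)
  have hc : ∀ {g : ℝ → ℝ}, AbsolutelyContinuousOnInterval g 0 1 →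
      AbsolutelyContinuousOnInterval (fun x => (g x : ℂ)) 0 1 := by
    intro g hg
    refine squeeze_zero (fun _ => Finset.sum_nonneg fun _ _ => dist_nonneg)
      (fun _ => Finset.sum_le_sum fun _ _ => ?_) hg
    rw [Complex.dist_eq, ← Complex.ofReal_sub, Complex.norm_real, Real.dist_eq, Real.norm_eq_abs]
  refine absolutelyContinuous_congr ((hc h1).add ((hc h2).const_smul Complex.I)) ?_
  intro x hx
  have hi := intervalIntegrable_of_mem hf (by simp : (0 : ℝ) ∈ Icc (0 : ℝ) 1) hx
  have e : ∀ t, f t = ((f t).re : ℂ) + Complex.I * ((f t).im : ℂ) := fun t => by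
    rw [mul_comm, Complex.re_add_im]
  have hre' : IntervalIntegrable (fun t => ((f t).re : ℂ)) volume 0 x :=
    ⟨hi.1.re.ofReal, hi.2.re.ofReal⟩
  have him' : IntervalIntegrable (fun t => ((f t).im : ℂ)) volume 0 x :=
    ⟨hi.1.im.ofReal, hi.2.im.ofReal⟩
  simp only [Pi.add_apply, smul_eq_mul]
  conv_rhs => rw [intervalIntegral.integral_congr fun t _ => e t]
  rw [intervalIntegral.integral_add hre' (him'.const_mul _), intervalIntegral.integral_const_mul,
    intervalIntegral.integral_ofReal, intervalIntegral.integral_ofReal]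

/-! ### Derivatives of functions in the weighted Sobolev spaces -/

lemma der_zero (g : ℝ → ℂ) : der 0 g = g := iteratedDerivWithin_zero

lemma der_succ (j : ℕ) (g : ℝ → ℂ) :
    der (j + 1) g = derivWithin (der j g) (Icc (0 : ℝ) 1) := iteratedDerivWithin_succ

lemma der_der (i j : ℕ) (g : ℝ → ℂ) : der i (der j g) = der (i + j) g := by
  induction i with
  | zero => rw [der_zero, zero_add]
  | succ i ih => rw [der_succ, ih, Nat.add_right_comm, der_succ]

/-- Extending `f` by its end values to a continuous function on the line makes the fundamental
theorem available at the end points as well. -/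
lemma hasDerivWithinAt_primitive {f : ℝ → ℂ} (hf : ContinuousOn f (Icc 0 1)) {x : ℝ}
    (hx : x ∈ Icc (0 : ℝ) 1) :
    HasDerivWithinAt (fun x => ∫ t in (0 : ℝ)..x, f t) (f x) (Icc 0 1) x := by
  have hc : Continuous (IccExtend zero_le_one ((Icc (0 : ℝ) 1).domRestrict f)) :=
    (continuousOn_iff_continuous_domRestrict.1 hf).Icc_extend'
  have he : ∀ t ∈ Icc (0 : ℝ) 1, IccExtend zero_le_one ((Icc (0 : ℝ) 1).domRestrict f) t = f t :=
    fun t ht => by rw [IccExtend_of_mem _ _ ht]; rfl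
  have h := (hc.integral_hasStrictDerivAt 0 x).hasDerivAt.hasDerivWithinAt (s := Icc (0 : ℝ) 1)
  rw [he x hx] at h
  have hI : ∀ y ∈ Icc (0 : ℝ) 1, ∫ t in (0 : ℝ)..y, f t
      = ∫ t in (0 : ℝ)..y, IccExtend zero_le_one ((Icc (0 : ℝ) 1).domRestrict f) t := by
    intro y hy
    refine intervalIntegral.integral_congr fun t ht => (he t ?_).symm
    rw [uIcc_of_le hy.1] at ht
    exact ⟨ht.1, ht.2.trans hy.2⟩
  exact h.congr hI (hI x hx)

section Sobolev

variable {b : ℝ → ℂ} {k : ℕ} {g h : ℝ → ℂ}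

lemma MemW.continuousOn (hg : MemW b k g) {j : ℕ} (hj : j < k) :
    ContinuousOn (der j g) (Icc 0 1) := by
  have := (hg.1 j hj).continuousOn
  rwa [uIcc_of_le zero_le_one] at this

lemma MemW.memWL2_der (hb : GoodWeight b) (hg : MemW b k g) {j : ℕ} (hj : j ≤ k) :
    MemWL2 b (der j g) := by
  rcases hj.lt_or_eq with hj | rfl
  · exact memWL2_of_continuousOn hb (hg.continuousOn hj)
  · exact hg.2

lemma MemW.integrable_der (hb : GoodWeight b) (hg : MemW b k g) {j : ℕ} (hj : j ≤ k) :
    Integrable (der j g) mu := (hg.memWL2_der hb hj).integrable hb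

lemma MemW.ae_hasDerivWithinAt (hg : MemW b k g) {j : ℕ} (hj : j < k) :
    ∀ᵐ x ∂mu, HasDerivWithinAt (der j g) (der (j + 1) g x) (Icc 0 1) x := by
  filter_upwards [ae_differentiableAt_of_ac (hg.1 j hj)] with x hx
  rw [der_succ]
  exact hx.differentiableWithinAt.hasDerivWithinAt

lemma ae_Icc_of_ae_mu {p : ℝ → Prop} (h : ∀ᵐ x ∂mu, p x) :
    ∀ᵐ x, x ∈ uIcc (0 : ℝ) 1 → x ∈ Ioo (0 : ℝ) 1 ∧ p x := by
  have h0 : ∀ᵐ x : ℝ, x ≠ 0 := by simp [ae_iff, measure_singleton]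
  have h1 : ∀ᵐ x : ℝ, x ≠ 1 := by simp [ae_iff, measure_singleton]
  rw [mu, ae_restrict_iff' measurableSet_Ioo] at h
  filter_upwards [h, h0, h1] with x hx hx0 hx1 hm
  rw [uIcc_of_le zero_le_one] at hm
  have hm' : x ∈ Ioo (0 : ℝ) 1 := ⟨lt_of_le_of_ne hm.1 hx0.symm, lt_of_le_of_ne hm.2 hx1⟩
  exact ⟨hm', hx hm'⟩

/-- The difference of the two sides is absolutely continuous with derivative zero almost everywhere,
hence constant. -/
lemma MemW.der_eq_add_integral (hb : GoodWeight b) (hg : MemW b k g) {j : ℕ} (hj : j < k)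
    {x : ℝ} (hx : x ∈ Icc (0 : ℝ) 1) :
    der j g x = der j g 0 + ∫ t in (0 : ℝ)..x, der (j + 1) g t := by
  have hi := hg.integrable_der hb (Nat.succ_le_of_lt hj)
  have hac := (hg.1 j hj).sub (absolutelyContinuous_primitive hi)
  have hder : ∀ᵐ x, x ∈ uIcc (0 : ℝ) 1 →
      HasDerivAt (der j g - fun x => ∫ t in (0 : ℝ)..x, der (j + 1) g t) 0 x := by
    filter_upwards [ae_Icc_of_ae_mu (hg.ae_hasDerivWithinAt hj),
      (intervalIntegrable_iff_mu.2 hi).ae_hasDerivAt_integral] with x h1 h2 hx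
    obtain ⟨hm, h1⟩ := h1 hx
    have := (h1.hasDerivAt (Icc_mem_nhds hm.1 hm.2)).sub (h2 hx 0 (by simp))
    rwa [sub_self] at this
  obtain ⟨C, hC⟩ := hac.const_of_ae_hasDerivAt_zero hder
  rw [uIcc_of_le zero_le_one] at hC
  have h0 := hC 0 (by simp)
  have h1 := hC x hx
  simp only [Pi.sub_apply, intervalIntegral.integral_same, sub_zero] at h0 h1
  rw [h0, ← h1]; ring

/-- Below the top order the next derivative is continuous, so differentiability holds at every point
of the closed interval and not just almost everywhere. -/
lemma MemW.hasDerivWithinAt (hb : GoodWeight b) (hg : MemW b k g) {j : ℕ} (hj : j + 1 < k)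
    {x : ℝ} (hx : x ∈ Icc (0 : ℝ) 1) :
    HasDerivWithinAt (der j g) (der (j + 1) g x) (Icc 0 1) x := by
  have h := (hasDerivWithinAt_primitive (hg.continuousOn hj) hx).const_add (der j g 0)
  exact h.congr (fun y hy => hg.der_eq_add_integral hb (by omega) hy)
    (hg.der_eq_add_integral hb (by omega) hx)

lemma MemW.der (hb : GoodWeight b) (hg : MemW b k g) {i m : ℕ} (him : i + m ≤ k) :
    MemW b i (der m g) := by
  refine ⟨fun j hj => ?_, ?_⟩
  · rw [der_der]; exact hg.1 _ (by omega)
  · rw [der_der]; exact hg.memWL2_der hb him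

lemma MemW0.der (hb : GoodWeight b) (hg : MemW0 b k g) {i m : ℕ} (him : i + m ≤ k) :
    MemW0 b i (der m g) := by
  refine ⟨hg.1.der hb him, fun j hj => ?_⟩
  rw [der_der]; exact hg.2 _ (by omega)

/-! ### The Leibniz rule -/

/-- The Leibniz sum for the `j`-th derivative of a product. -/
def leib (j : ℕ) (g h : ℝ → ℂ) (x : ℝ) : ℂ :=
  ∑ ij ∈ Finset.HasAntidiagonal.antidiagonal j, (j.choose ij.1 : ℂ) * (der ij.1 g x * der ij.2 h x)

lemma hasDerivWithinAt_leib {j : ℕ} {x : ℝ}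
    (hg : ∀ i ≤ j, HasDerivWithinAt (der i g) (der (i + 1) g x) (Icc 0 1) x)
    (hh : ∀ i ≤ j, HasDerivWithinAt (der i h) (der (i + 1) h x) (Icc 0 1) x) :
    HasDerivWithinAt (leib j g h) (leib (j + 1) g h x) (Icc 0 1) x := by
  have h1 : HasDerivWithinAt (leib j g h)
      (∑ ij ∈ Finset.HasAntidiagonal.antidiagonal j, (j.choose ij.1 : ℂ) *
        (der (ij.1 + 1) g x * der ij.2 h x + der ij.1 g x * der (ij.2 + 1) h x))
      (Icc 0 1) x := by
    unfold leib
    refine HasDerivWithinAt.fun_sum fun ij hij => ?_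
    rw [Finset.HasAntidiagonal.mem_antidiagonal] at hij
    exact ((hg ij.1 (by omega)).mul (hh ij.2 (by omega))).const_mul _
  refine h1.congr_deriv ?_
  unfold leib
  rw [Finset.sum_antidiagonal_choose_succ_mul (fun a c => der a g x * der c h x) j,
    ← Finset.sum_add_distrib]
  refine Finset.sum_congr rfl fun ij hij => ?_
  rw [Finset.HasAntidiagonal.mem_antidiagonal] at hij
  rw [← Nat.choose_symm_of_eq_add hij.symm]
  ring

lemma MemW.der_mul (hb : GoodWeight b) (hg : MemW b k g) (hh : MemW b k h) {j : ℕ}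
    (hj : j < k) : EqOn (SingExpr.der j (fun x => g x * h x)) (leib j g h) (Icc 0 1) := by
  induction j with
  | zero => intro x _; simp [leib, der_zero]
  | succ j ih =>
    intro x hx
    rw [der_succ, derivWithin_congr (ih (by omega)) (ih (by omega) hx)]
    exact (hasDerivWithinAt_leib (fun i hi => hg.hasDerivWithinAt hb (by omega) hx)
      (fun i hi => hh.hasDerivWithinAt hb (by omega) hx)).derivWithin
        (uniqueDiffOn_Icc zero_lt_one x hx)

lemma MemW.der_mul_ae (hb : GoodWeight b) (hg : MemW b k g) (hh : MemW b k h) :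
    SingExpr.der k (fun x => g x * h x) =ᵐ[mu] leib k g h := by
  cases k with
  | zero => exact Filter.Eventually.of_forall fun x => by simp [leib, der_zero]
  | succ k =>
    have e := hg.der_mul hb hh k.lt_succ_self
    have h1 : ∀ᵐ x ∂mu, ∀ i ∈ Finset.range (k + 1),
        HasDerivWithinAt (SingExpr.der i g) (SingExpr.der (i + 1) g x) (Icc 0 1) x :=
      (Finset.eventually_all _).2 fun i hi => hg.ae_hasDerivWithinAt (Finset.mem_range.1 hi)
    have h2 : ∀ᵐ x ∂mu, ∀ i ∈ Finset.range (k + 1),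
        HasDerivWithinAt (SingExpr.der i h) (SingExpr.der (i + 1) h x) (Icc 0 1) x :=
      (Finset.eventually_all _).2 fun i hi => hh.ae_hasDerivWithinAt (Finset.mem_range.1 hi)
    filter_upwards [h1, h2, ae_mu_mem] with x h1 h2 hx
    have hx := Ioo_subset_Icc_self hx
    rw [der_succ, derivWithin_congr e (e hx)]
    exact (hasDerivWithinAt_leib
      (fun i hi => h1 i (Finset.mem_range.2 (Nat.lt_succ_of_le hi)))
      (fun i hi => h2 i (Finset.mem_range.2 (Nat.lt_succ_of_le hi)))).derivWithin
        (uniqueDiffOn_Icc zero_lt_one x hx)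

lemma absolutelyContinuous_const (c : ℂ) :
    AbsolutelyContinuousOnInterval (fun _ => c) 0 1 := by
  simp [absolutelyContinuousOnInterval_iff]
  exact fun ε hε => ⟨1, one_pos, fun _ _ _ _ => hε⟩

lemma absolutelyContinuous_mul {f g : ℝ → ℂ} (hf : AbsolutelyContinuousOnInterval f 0 1)
    (hg : AbsolutelyContinuousOnInterval g 0 1) :
    AbsolutelyContinuousOnInterval (fun x => f x * g x) 0 1 := by
  simpa only [smul_eq_mul] using hf.fun_smul hg

lemma absolutelyContinuous_sum {ι : Type*} (s : Finset ι) {f : ι → ℝ → ℂ}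
    (hf : ∀ i ∈ s, AbsolutelyContinuousOnInterval (f i) 0 1) :
    AbsolutelyContinuousOnInterval (fun x => ∑ i ∈ s, f i x) 0 1 := by
  classical
  induction s using Finset.induction_on with
  | empty => simpa using absolutelyContinuous_const 0
  | insert i s hi ih =>
    simp only [Finset.sum_insert hi]
    exact (hf i (Finset.mem_insert_self _ _)).fun_add
      (ih fun j hj => hf j (Finset.mem_insert_of_mem hj))

/-- The case k = 0 is excluded because a product of two functions in L_{2,b} need not lie in
L_{2,b}. For k ≥ 1 each Leibniz term of order k has at most one factor of top order, and the other
factor is continuous. -/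
lemma MemW.mul (hb : GoodWeight b) (hk : 1 ≤ k) (hg : MemW b k g) (hh : MemW b k h) :
    MemW b k (fun x => g x * h x) := by
  refine ⟨fun j hj => ?_, ?_⟩
  · refine absolutelyContinuous_congr ?_ (hg.der_mul hb hh hj).symm
    refine absolutelyContinuous_sum _ fun ij hij => ?_
    rw [Finset.HasAntidiagonal.mem_antidiagonal] at hij
    exact absolutelyContinuous_mul (absolutelyContinuous_const _)
      (absolutelyContinuous_mul (hg.1 ij.1 (by omega)) (hh.1 ij.2 (by omega)))
  · refine MemWL2.congr ?_ (hg.der_mul_ae hb hh).symm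
    refine MemWL2.sum _ fun ij hij => ?_
    rw [Finset.HasAntidiagonal.mem_antidiagonal] at hij
    refine MemWL2.const_mul ?_ _
    by_cases hlt : ij.2 < k
    · exact (hg.memWL2_der hb (by omega)).mul_continuousOn hb (hh.continuousOn hlt)
    · simp only [mul_comm (SingExpr.der ij.1 g _)]
      exact (hh.memWL2_der hb (by omega)).mul_continuousOn hb (hg.continuousOn (by omega))

lemma MemW0.mul (hb : GoodWeight b) (hk : 1 ≤ k) (hg : MemW0 b k g) (hh : MemW b k h) :
    MemW0 b k (fun x => g x * h x) := by
  refine ⟨hg.1.mul hb hk hh, fun j hj => ?_⟩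
  have key : ∀ x ∈ Icc (0 : ℝ) 1, (∀ i < k, SingExpr.der i g x = 0) →
      SingExpr.der j (fun x => g x * h x) x = 0 := by
    intro x hx h0
    rw [hg.1.der_mul hb hh hj hx]
    refine Finset.sum_eq_zero fun ij hij => ?_
    rw [Finset.HasAntidiagonal.mem_antidiagonal] at hij
    rw [h0 ij.1 (by omega), zero_mul, mul_zero]
  exact ⟨key 0 (by simp) fun i hi => (hg.2 i hi).1, key 1 (by simp) fun i hi => (hg.2 i hi).2⟩

/-! ### Taylor's formula and repeated integration by parts -/

lemma integral_pow_div_factorial (m : ℕ) (x : ℝ) :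
    ∫ t in (0 : ℝ)..x, (t : ℂ) ^ m / (m.factorial : ℂ)
      = (x : ℂ) ^ (m + 1) / ((m + 1).factorial : ℂ) := by
  simpa using integral_sub_pow_div_factorial m 0 x

/-- The order is counted down from n, so that j is the number of integrations leading from g^{(n)}
to the derivative considered. -/
lemma MemW.der_eq_taylor (hb : GoodWeight b) {n : ℕ} (hg : MemW b n g) {j : ℕ} (hj : j ≤ n)
    {x : ℝ} (hx : x ∈ Icc (0 : ℝ) 1) :
    SingExpr.der (n - j) g x =
      (∑ m ∈ Finset.range j, SingExpr.der (n - j + m) g 0 * ((x : ℂ) ^ m / (m.factorial : ℂ)))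
        + volt j (SingExpr.der n g) x := by
  induction j generalizing x with
  | zero => simp [volt]
  | succ j ih =>
    have hi := hg.integrable_der hb le_rfl
    have hs : n - (j + 1) + 1 = n - j := by omega
    have h0 : (0 : ℝ) ∈ Icc (0 : ℝ) 1 := by simp
    rw [hg.der_eq_add_integral hb (by omega) hx, hs, volt_succ hi j hx]
    have e : ∫ t in (0 : ℝ)..x, SingExpr.der (n - j) g t = ∫ t in (0 : ℝ)..x,
        ((∑ m ∈ Finset.range j,
          SingExpr.der (n - j + m) g 0 * ((t : ℂ) ^ m / (m.factorial : ℂ)))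
          + volt j (SingExpr.der n g) t) := by
      refine intervalIntegral.integral_congr fun t ht => ih (by omega) ?_
      rw [uIcc_of_le hx.1] at ht
      exact ⟨ht.1, ht.2.trans hx.2⟩
    have hc : ∀ m ∈ Finset.range j, IntervalIntegrable (fun t : ℝ =>
        SingExpr.der (n - j + m) g 0 * ((t : ℂ) ^ m / (m.factorial : ℂ))) volume 0 x :=
      fun m _ => Continuous.intervalIntegrable (by fun_prop) _ _
    rw [e, intervalIntegral.integral_add (by
        apply Continuous.intervalIntegrable; fun_prop)
      (intervalIntegrable_of_mem (integrable_volt hi j) h0 hx),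
      intervalIntegral.integral_finsetSum hc, Finset.sum_range_succ']
    simp only [intervalIntegral.integral_const_mul, integral_pow_div_factorial]
    have e2 : ∀ m, n - (j + 1) + (m + 1) = n - j + m := by intro m; omega
    simp only [e2]
    simp
    ring

/-- Integration by parts for a merely integrable S, carried out by Fubini: φ^{(m)}(t) is minus the
integral of φ^{(m+1)} over (t, 1), because φ^{(m)} vanishes at 1. The primitive of S vanishes at 0.
-/
lemma MemW0.integral_mul_der_succ (hb : GoodWeight b) {φ S : ℝ → ℂ} (hφ : MemW0 b k φ)
    (hS : Integrable S mu) {m : ℕ} (hm : m < k) :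
    ∫ x, S x * SingExpr.der m φ x ∂mu
      = -∫ x, (∫ t in (0 : ℝ)..x, S t) * SingExpr.der (m + 1) φ x ∂mu := by
  have hi := hφ.1.integrable_der hb (Nat.succ_le_of_lt hm)
  have h1 : (1 : ℝ) ∈ Icc (0 : ℝ) 1 := by simp
  have h0 : (0 : ℝ) ∈ Icc (0 : ℝ) 1 := by simp
  have h := integral_triangle_swap (w := fun _ _ => 1) hi hS
    (by unfold Function.uncurry; fun_prop) h1
  simp only [one_mul, mul_one, intervalIntegral_zero_one] at h
  rw [integral_congr_ae (Filter.Eventually.of_forall fun x => mul_comm _ _)] at h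
  rw [h, ← integral_neg]
  refine integral_congr_ae ?_
  filter_upwards [ae_mu_mem] with t ht
  have ht := Ioo_subset_Icc_self ht
  have e : ∫ τ in t..1, SingExpr.der (m + 1) φ τ = - SingExpr.der m φ t := by
    rw [← intervalIntegral.integral_interval_sub_left (intervalIntegrable_of_mem hi h0 h1)
      (intervalIntegrable_of_mem hi h0 ht)]
    have e1 := hφ.1.der_eq_add_integral hb hm h1
    have e2 := hφ.1.der_eq_add_integral hb hm ht
    rw [(hφ.2 m hm).2] at e1
    linear_combination e2 - e1
  simp only [e]
  ring

lemma MemW0.integral_mul_der (hb : GoodWeight b) {φ S : ℝ → ℂ} (hφ : MemW0 b k φ)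
    (hS : Integrable S mu) {m i : ℕ} (hmi : m + i ≤ k) :
    ∫ x, S x * SingExpr.der m φ x ∂mu
      = (-1) ^ i * ∫ x, volt i S x * SingExpr.der (m + i) φ x ∂mu := by
  induction i with
  | zero => simp [volt]
  | succ i ih =>
    rw [ih (by omega), hφ.integral_mul_der_succ hb (integrable_volt hS i) (by omega), pow_succ,
      ← add_assoc]
    rw [mul_neg, mul_neg_one, neg_mul]
    congr 2
    refine integral_congr_ae ?_
    filter_upwards [ae_mu_mem] with x hx
    rw [volt_succ hS i (Ioo_subset_Icc_self hx)]

/-! ### Iterated primitives as elements of the Sobolev spaces -/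

/-- The index j + (m + 1) leaves at least one integration after j derivatives, which makes the
identity valid at every point; with none left it holds only almost everywhere (`der_volt_self`). -/
lemma der_volt {f : ℝ → ℂ} (hf : Integrable f mu) (j m : ℕ) :
    EqOn (SingExpr.der j (volt (j + (m + 1)) f)) (volt (m + 1) f) (Icc 0 1) := by
  induction j generalizing m with
  | zero => intro x _; rw [der_zero, zero_add]
  | succ j ih =>
    have e : j + 1 + (m + 1) = j + (m + 1 + 1) := by omega
    intro x hx
    rw [der_succ, e, derivWithin_congr (ih (m + 1)) (ih (m + 1) hx),
      derivWithin_congr (fun y hy => volt_succ hf (m + 1) hy) (volt_succ hf (m + 1) hx)]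
    exact (hasDerivWithinAt_primitive (continuousOn_volt_succ hf m) hx).derivWithin
      (uniqueDiffOn_Icc zero_lt_one x hx)

lemma der_volt_self {f : ℝ → ℂ} (hf : Integrable f mu) (n : ℕ) :
    SingExpr.der n (volt n f) =ᵐ[mu] f := by
  cases n with
  | zero => rw [der_zero]; rfl
  | succ n =>
    filter_upwards [ae_mu_of_ae (intervalIntegrable_iff_mu.2 hf).ae_hasDerivAt_integral,
      ae_mu_mem] with x h1 hx
    have hx := Ioo_subset_Icc_self hx
    rw [der_succ, derivWithin_congr (der_volt hf n 0) (der_volt hf n 0 hx),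
      derivWithin_congr (fun y hy => volt_succ hf 0 hy) (volt_succ hf 0 hx)]
    exact (h1 (by rwa [uIcc_of_le zero_le_one]) 0 (by simp)).hasDerivWithinAt.derivWithin
      (uniqueDiffOn_Icc zero_lt_one x hx)

lemma memW_volt (hb : GoodWeight b) {f : ℝ → ℂ} (hf : MemWL2 b f) (n : ℕ) :
    MemW b n (volt n f) := by
  have hi := hf.integrable hb
  refine ⟨fun j hj => ?_, hf.congr (der_volt_self hi n).symm⟩
  obtain ⟨m, rfl⟩ : ∃ m, n = j + (m + 1) := ⟨n - j - 1, by omega⟩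
  refine absolutelyContinuous_congr ?_ (der_volt hi j m).symm
  exact absolutelyContinuous_congr (absolutelyContinuous_primitive (integrable_volt hi m))
    fun x hx => (volt_succ hi m hx).symm

end Sobolev

/-! ### Square integrable kernels -/

lemma eLpNorm_two_sq {α : Type*} [MeasurableSpace α] {ν : Measure α} (f : α → ℂ) :
    eLpNorm f 2 ν ^ (2 : ℝ) = ∫⁻ x, ‖f x‖ₑ ^ (2 : ℝ) ∂ν := by
  have := eLpNorm_nnreal_pow_eq_lintegral (f := f) (μ := ν) (p := 2) two_ne_zero
  simpa using this

/-- The Hilbert–Schmidt bound: Cauchy–Schwarz in t for almost every x, then integration in x. -/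
lemma eLpNorm_integral_le {k : ℝ × ℝ → ℂ} {F : ℝ → ℂ}
    (hk : AEStronglyMeasurable k (mu.prod mu)) (hF : AEStronglyMeasurable F mu) :
    eLpNorm (fun x => ∫ t, k (x, t) * F t ∂mu) 2 mu
      ≤ eLpNorm k 2 (mu.prod mu) * eLpNorm F 2 mu := by
  have h2 : (0 : ℝ) < 2 := two_pos
  rw [← ENNReal.rpow_le_rpow_iff h2, ENNReal.mul_rpow_of_nonneg _ _ h2.le, eLpNorm_two_sq,
    eLpNorm_two_sq, eLpNorm_two_sq, lintegral_prod _ (hk.enorm.pow_const _),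
    ← lintegral_mul_const'' _ (hk.enorm.pow_const _).lintegral_prod_right']
  refine lintegral_mono_ae ?_
  filter_upwards [hk.prodMk_left] with x hx
  have h1 : ‖∫ t, k (x, t) * F t ∂mu‖ₑ
      ≤ (∫⁻ t, ‖k (x, t)‖ₑ ^ (2 : ℝ) ∂mu) ^ (1 / (2 : ℝ))
        * (∫⁻ t, ‖F t‖ₑ ^ (2 : ℝ) ∂mu) ^ (1 / (2 : ℝ)) := by
    refine (enorm_integral_le_lintegral_enorm _).trans ?_
    simp only [enorm_mul]
    exact ENNReal.lintegral_mul_le_Lp_mul_Lq mu Real.HolderConjugate.two_two hx.enorm hF.enorm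
  refine (ENNReal.rpow_le_rpow h1 h2.le).trans_eq ?_
  rw [ENNReal.mul_rpow_of_nonneg _ _ h2.le, ← ENNReal.rpow_mul, ← ENNReal.rpow_mul]
  norm_num

lemma memLp_integral {k : ℝ × ℝ → ℂ} {F : ℝ → ℂ} (hk : MemLp k 2 (mu.prod mu))
    (hF : MemLp F 2 mu) : MemLp (fun x => ∫ t, k (x, t) * F t ∂mu) 2 mu :=
  ⟨(hk.1.mul hF.1.comp_snd).integral_prod_right',
    (eLpNorm_integral_le hk.1 hF.1).trans_lt (ENNReal.mul_lt_top hk.2 hF.2)⟩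

lemma ae_integrable_section {k : ℝ × ℝ → ℂ} {F : ℝ → ℂ} (hk : MemLp k 2 (mu.prod mu))
    (hF : MemLp F 2 mu) : ∀ᵐ x ∂mu, Integrable (fun t => k (x, t) * F t) mu := by
  have h := ((memLp_two_iff_integrable_sq_norm hk.1).1 hk).prod_right_ae
  filter_upwards [h, hk.1.prodMk_left] with x h1 h2
  exact ((memLp_two_iff_integrable_sq_norm h2).2 h1).integrable_mul hF

lemma ae_eq_zero_of_add_integral {k : ℝ × ℝ → ℂ} {F : ℝ → ℂ} (hk : MemLp k 2 (mu.prod mu))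
    (hlt : eLpNorm k 2 (mu.prod mu) < 1) (hF : MemLp F 2 mu)
    (h : ∀ᵐ x ∂mu, F x + ∫ t, k (x, t) * F t ∂mu = 0) : F =ᵐ[mu] 0 := by
  have h1 : eLpNorm F 2 mu = eLpNorm (fun x => ∫ t, k (x, t) * F t ∂mu) 2 mu := by
    refine eLpNorm_congr_norm_ae ?_
    filter_upwards [h] with x hx
    rw [eq_neg_of_add_eq_zero_left hx, norm_neg]
  have h2 := h1.trans_le (eLpNorm_integral_le hk.1 hF.1)
  rw [← eLpNorm_eq_zero_iff hF.1 two_ne_zero]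
  by_contra h0
  have h3 := ENNReal.mul_lt_mul_left h0 hF.2.ne hlt
  rw [one_mul] at h3
  exact absurd h2 (not_le.2 h3)

/-- Banach's fixed point theorem for F ↦ H - ∫ k F on L₂, a contraction by the Hilbert–Schmidt
bound. -/
lemma exists_add_integral_eq {k : ℝ × ℝ → ℂ} {H : ℝ → ℂ} (hk : MemLp k 2 (mu.prod mu))
    (hlt : eLpNorm k 2 (mu.prod mu) < 1) (hH : MemLp H 2 mu) :
    ∃ F : ℝ → ℂ, MemLp F 2 mu ∧ ∀ᵐ x ∂mu, F x + ∫ t, k (x, t) * F t ∂mu = H x := by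
  have hmem : ∀ F : Lp ℂ 2 mu, MemLp (fun x => H x - ∫ t, k (x, t) * F t ∂mu) 2 mu :=
    fun F => hH.sub (memLp_integral hk (Lp.memLp F))
  set Φ : Lp ℂ 2 mu → Lp ℂ 2 mu := fun F => (hmem F).toLp with hΦ
  have hc : ContractingWith (eLpNorm k 2 (mu.prod mu)).toNNReal Φ := by
    refine ⟨?_, fun F G => ?_⟩
    · rw [← ENNReal.coe_lt_coe, ENNReal.coe_toNNReal hk.2.ne]; exact hlt
    · rw [ENNReal.coe_toNNReal hk.2.ne, Lp.edist_toLp_toLp, Lp.edist_def]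
      refine le_trans (le_of_eq ?_) (eLpNorm_integral_le hk.1
        ((Lp.aestronglyMeasurable F).sub (Lp.aestronglyMeasurable G)))
      refine eLpNorm_congr_norm_ae ?_
      filter_upwards [ae_integrable_section hk (Lp.memLp F),
        ae_integrable_section hk (Lp.memLp G)] with x h1 h2
      simp only [Pi.sub_apply, mul_sub]
      rw [integral_sub h1 h2, ← norm_neg]
      congr 1
      ring
  refine ⟨hc.fixedPoint, Lp.memLp _, ?_⟩
  have h1 : Φ hc.fixedPoint = hc.fixedPoint := hc.fixedPoint_isFixedPt
  have h2 : (Φ hc.fixedPoint : ℝ → ℂ) =ᵐ[mu] _ := (hmem hc.fixedPoint).coeFn_toLp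
  rw [h1] at h2
  filter_upwards [h2] with x hx
  rw [hx, sub_add_cancel]

/-! ### Volterra kernels -/

lemma measurableSet_triangle : MeasurableSet triangle :=
  (measurableSet_lt measurable_const measurable_snd).inter
    ((measurableSet_lt measurable_snd measurable_fst).inter
      (measurableSet_lt measurable_fst measurable_const))

lemma mu_prod_mu : mu.prod mu =
    (volume : Measure (ℝ × ℝ)).restrict (Ioo (0 : ℝ) 1 ×ˢ Ioo (0 : ℝ) 1) := by
  rw [mu, Measure.prod_restrict]; rfl

lemma restrict_triangle :
    (mu.prod mu).restrict triangle = (volume : Measure (ℝ × ℝ)).restrict triangle := by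
  rw [mu_prod_mu, Measure.restrict_restrict measurableSet_triangle,
    inter_eq_self_of_subset_left]
  rintro ⟨x, t⟩ ⟨h1, h2, h3⟩
  exact ⟨⟨h1.trans h2, h3⟩, ⟨h1, h2.trans h3⟩⟩

/-- The kernel `κ` extended by zero outside the triangle. -/
def cut (κ : ℝ → ℝ → ℂ) : ℝ × ℝ → ℂ := triangle.indicator (Function.uncurry κ)

/-- The kernels satisfying the measurability and the bound of the theorem. -/
structure GoodKernel (b : ℝ → ℂ) (κ : ℝ → ℝ → ℂ) : Prop where
  aesm : AEStronglyMeasurable (cut κ) (mu.prod mu)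
  bound : ∃ a : ℝ → ℝ, MemWL2 (recip b) (fun x => (a x : ℂ)) ∧
    ∀ x t : ℝ, 0 < t → t < x → x < 1 → ‖κ x t‖ ≤ a x + a t

lemma cut_of_mem {κ : ℝ → ℝ → ℂ} {x t : ℝ} (h0 : 0 < t) (h1 : t < x) (h2 : x < 1) :
    cut κ (x, t) = κ x t :=
  indicator_of_mem (show (x, t) ∈ triangle from ⟨h0, h1, h2⟩) _

lemma integral_kernel_eq {κ : ℝ → ℝ → ℂ} (f : ℝ → ℂ) {x : ℝ} (hx : x ∈ Ioo (0 : ℝ) 1) :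
    ∫ t in (0 : ℝ)..x, κ x t * f t = ∫ t, cut κ (x, t) * f t ∂mu := by
  rw [intervalIntegral_zero_left (Ioo_subset_Icc_self hx)]
  refine integral_congr_ae ?_
  filter_upwards [ae_mu_mem] with t ht
  by_cases h : t < x
  · rw [cut_of_mem ht.1 h hx.2, indicator_of_mem (show t ∈ Iio x from h)]
  · rw [indicator_of_notMem (show t ∉ Iio x from h), cut,
      indicator_of_notMem (fun hm => h hm.2.1), zero_mul]

section Kernel

variable {b : ℝ → ℂ} {κ : ℝ → ℝ → ℂ}

lemma GoodKernel.aesm_triangle (hκ : GoodKernel b κ) :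
    AEStronglyMeasurable (Function.uncurry κ)
      ((volume : Measure (ℝ × ℝ)).restrict triangle) := by
  rw [← restrict_triangle]
  exact (aestronglyMeasurable_indicator_iff measurableSet_triangle).1 hκ.aesm

/-- Passing from a to |a| makes the bound hold on the whole plane for the kernel cut off outside the
triangle. -/
lemma GoodKernel.exists_norm_le (hb : GoodWeight b) (hκ : GoodKernel b κ) :
    ∃ A : ℝ → ℝ, (∀ x, 0 ≤ A x) ∧ MemWL2 (recip b) (fun x => (A x : ℂ)) ∧
      ∀ z, ‖cut κ z‖ ≤ A z.1 + A z.2 := by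
  obtain ⟨a, ha, h⟩ := hκ.bound
  refine ⟨fun x => ‖(a x : ℂ)‖, fun x => norm_nonneg _, ha.norm hb.recip, fun z => ?_⟩
  by_cases hz : z ∈ triangle
  · rw [cut, indicator_of_mem hz]
    refine (h z.1 z.2 hz.1 hz.2.1 hz.2.2).trans ?_
    simp only [Complex.norm_real, Real.norm_eq_abs]
    exact add_le_add (le_abs_self _) (le_abs_self _)
  · rw [cut, indicator_of_notMem hz, norm_zero]
    positivity

lemma GoodKernel.ae_integrable (hb : GoodWeight b) (hκ : GoodKernel b κ) {f : ℝ → ℂ}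
    (hf : MemWL2 b f) : ∀ᵐ x ∂mu, Integrable (fun t => cut κ (x, t) * f t) mu := by
  obtain ⟨A, hA0, hA, h⟩ := hκ.exists_norm_le hb
  filter_upwards [hκ.aesm.prodMk_left] with x hx
  have h1 : Integrable (fun t => ((A x : ℂ) + A t) * f t) mu :=
    ((memWL2_const hb.recip (A x : ℂ)).add hA).integrable_mul hb hf
  refine h1.mono (hx.mul hf.1) (Filter.Eventually.of_forall fun t => ?_)
  rw [norm_mul, norm_mul]
  gcongr
  refine (h (x, t)).trans ?_
  rw [← Complex.ofReal_add, Complex.norm_real]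
  exact le_abs_self _

lemma GoodKernel.ae_intervalIntegrable (hb : GoodWeight b) (hκ : GoodKernel b κ) {f : ℝ → ℂ}
    (hf : MemWL2 b f) :
    ∀ᵐ x ∂mu, IntervalIntegrable (fun t => κ x t * f t) volume 0 x := by
  filter_upwards [hκ.ae_integrable hb hf, ae_mu_mem] with x h1 hx
  rw [intervalIntegrable_iff_integrableOn_Ioo_of_le hx.1.le]
  have h2 : IntegrableOn (fun t => cut κ (x, t) * f t) (Ioo 0 x) volume :=
    IntegrableOn.mono_set h1 (Ioo_subset_Ioo le_rfl hx.2.le)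
  exact h2.congr_fun (fun t ht => by simp only [cut_of_mem ht.1 ht.2 hx.2]) measurableSet_Ioo

lemma GoodKernel.memWL2_integral (hb : GoodWeight b) (hκ : GoodKernel b κ) {f : ℝ → ℂ}
    (hf : MemWL2 b f) : MemWL2 (recip b) (fun x => ∫ t in (0 : ℝ)..x, κ x t * f t) := by
  obtain ⟨A, hA0, hA, h⟩ := hκ.exists_norm_le hb
  have hae : (fun x => ∫ t, cut κ (x, t) * f t ∂mu)
      =ᵐ[mu] fun x => ∫ t in (0 : ℝ)..x, κ x t * f t := by
    filter_upwards [ae_mu_mem] with x hx using (integral_kernel_eq f hx).symm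
  refine MemWL2.congr ?_ hae
  have hfi := (hf.integrable hb).norm
  have hAf : Integrable (fun t => A t * ‖f t‖) mu := by
    refine (hA.integrable_mul hb hf).norm.congr (Filter.Eventually.of_forall fun t => ?_)
    simp only [norm_mul, Complex.norm_real, Real.norm_of_nonneg (hA0 t)]
  -- The majorant comes from integrating (A(x) + A(t)) |f(t)| over t: a multiple of A plus a
  -- constant, both in L_{2,1/b}.
  have hdom : MemWL2 (recip b) (fun x => (A x : ℂ) * ((∫ t, ‖f t‖ ∂mu : ℝ) : ℂ)
      + ((∫ t, A t * ‖f t‖ ∂mu : ℝ) : ℂ)) := by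
    refine MemWL2.add ?_ (memWL2_const hb.recip _)
    exact (hA.const_mul ((∫ t, ‖f t‖ ∂mu : ℝ) : ℂ)).congr
      (Filter.Eventually.of_forall fun x => mul_comm _ _)
  refine MemWL2.of_norm_le hb.recip hdom (hκ.aesm.mul hf.1.comp_snd).integral_prod_right'
    (Filter.Eventually.of_forall fun x => ?_)
  have h1 : ‖∫ t, cut κ (x, t) * f t ∂mu‖
      ≤ ∫ t, (A x * ‖f t‖ + A t * ‖f t‖) ∂mu := by
    refine norm_integral_le_of_norm_le ((hfi.const_mul _).add hAf)
      (Filter.Eventually.of_forall fun t => ?_)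
    rw [norm_mul, ← add_mul]
    gcongr
    exact h (x, t)
  refine h1.trans ?_
  rw [integral_add (hfi.const_mul _) hAf, integral_const_mul, ← Complex.ofReal_mul,
    ← Complex.ofReal_add, Complex.norm_real]
  exact le_abs_self _

lemma GoodKernel.integrable_cut (hb : GoodWeight b) (hκ : GoodKernel b κ) :
    Integrable (cut κ) (mu.prod mu) := by
  obtain ⟨A, hA0, hA, h⟩ := hκ.exists_norm_le hb
  have hi := hA.integrable hb.recip
  refine ((hi.comp_fst mu).add (hi.comp_snd mu)).mono hκ.aesm
    (Filter.Eventually.of_forall fun z => (h z).trans ?_)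
  simp only [Pi.add_apply, ← Complex.ofReal_add, Complex.norm_real]
  exact le_abs_self _

/-! ### Bijectivity of the operator `B` -/

/-- The kernel of the operator on `L₂(0,1)` obtained from `κ` by conjugation with the weight `b` and
with the exponential `e^{-mx}`. -/
def conjKernel (b : ℝ → ℂ) (κ : ℝ → ℝ → ℂ) (m : ℕ) (z : ℝ × ℝ) : ℂ :=
  Complex.exp (-(m * (z.1 - z.2))) * (recip b z.1 * recip b z.2 * cut κ z)

lemma memLp_mul_prod {f g : ℝ → ℂ} (hf : MemLp f 2 mu) (hg : MemLp g 2 mu) :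
    MemLp (fun z : ℝ × ℝ => f z.1 * g z.2) 2 (mu.prod mu) := by
  have hm : AEStronglyMeasurable (fun z : ℝ × ℝ => f z.1 * g z.2) (mu.prod mu) :=
    hf.1.comp_fst.mul hg.1.comp_snd
  rw [memLp_two_iff_integrable_sq_norm hm]
  have h := ((memLp_two_iff_integrable_sq_norm hf.1).1 hf).mul_prod
    ((memLp_two_iff_integrable_sq_norm hg.1).1 hg)
  simpa only [norm_mul, mul_pow] using h

lemma aesm_conjKernel (hb : GoodWeight b) (hκ : GoodKernel b κ) (m : ℕ) :
    AEStronglyMeasurable (conjKernel b κ m) (mu.prod mu) := by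
  have hc : Continuous fun z : ℝ × ℝ => Complex.exp (-((m : ℂ) * ((z.1 : ℂ) - (z.2 : ℂ)))) := by
    fun_prop
  exact hc.aestronglyMeasurable.mul
    ((hb.memLp_recip.1.comp_fst.mul hb.memLp_recip.1.comp_snd).mul hκ.aesm)

lemma norm_conjKernel_le (b : ℝ → ℂ) (κ : ℝ → ℝ → ℂ) (m : ℕ) (z : ℝ × ℝ) :
    ‖conjKernel b κ m z‖ ≤ ‖conjKernel b κ 0 z‖ := by
  by_cases hz : z ∈ triangle
  · simp only [conjKernel, Nat.cast_zero, zero_mul, neg_zero, Complex.exp_zero, one_mul]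
    rw [norm_mul]
    refine mul_le_of_le_one_left (norm_nonneg _) ?_
    rw [Complex.norm_exp]
    have : (-((m : ℂ) * ((z.1 : ℂ) - z.2))).re = -(m * (z.1 - z.2)) := by simp
    rw [this, Real.exp_le_one_iff]
    have h1 : 0 ≤ z.1 - z.2 := sub_nonneg.2 hz.2.1.le
    have : 0 ≤ (m : ℝ) * (z.1 - z.2) := by positivity
    linarith
  · simp [conjKernel, cut, indicator_of_notMem hz]

/-- Dominated by (A/b)(x) (1/b)(t) plus its mirror image, up to absolute values; both are products
of square integrable functions of one variable. -/
lemma memLp_conjKernel (hb : GoodWeight b) (hκ : GoodKernel b κ) (m : ℕ) :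
    MemLp (conjKernel b κ m) 2 (mu.prod mu) := by
  obtain ⟨A, hA0, hA, h⟩ := hκ.exists_norm_le hb
  refine ((memLp_mul_prod hA.2 hb.memLp_recip).norm.add
    (memLp_mul_prod hb.memLp_recip hA.2).norm).mono (aesm_conjKernel hb hκ m)
    (Filter.Eventually.of_forall fun z => (norm_conjKernel_le b κ m z).trans ?_)
  have h1 := mul_le_mul_of_nonneg_left (h z)
    (mul_nonneg (norm_nonneg (recip b z.1)) (norm_nonneg (recip b z.2)))
  simp only [conjKernel, Nat.cast_zero, zero_mul, neg_zero, Complex.exp_zero, one_mul,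
    Pi.add_apply, norm_mul, Complex.norm_real, Real.norm_of_nonneg (hA0 _)]
  refine h1.trans (le_trans (le_of_eq ?_) (le_abs_self _))
  ring

/-- Dominated convergence with the kernel for m = 0 as majorant. Strictness of t < x on the triangle
makes e^{-m(x-t)} tend to 0 pointwise. -/
lemma exists_eLpNorm_conjKernel_lt (hb : GoodWeight b) (hκ : GoodKernel b κ) :
    ∃ m : ℕ, eLpNorm (conjKernel b κ m) 2 (mu.prod mu) < 1 := by
  have hlim : Filter.Tendsto
      (fun m : ℕ => ∫⁻ z, ‖conjKernel b κ m z‖ₑ ^ (2 : ℝ) ∂mu.prod mu) Filter.atTop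
      (nhds (∫⁻ _, 0 ∂mu.prod mu)) := by
    refine tendsto_lintegral_of_dominated_convergence'
      (fun z => ‖conjKernel b κ 0 z‖ₑ ^ (2 : ℝ))
      (fun m => (aesm_conjKernel hb hκ m).enorm.pow_const _)
      (fun m => Filter.Eventually.of_forall fun z => ?_) ?_
      (Filter.Eventually.of_forall fun z => ?_)
    · refine ENNReal.rpow_le_rpow ?_ two_pos.le
      exact enorm_le_iff_norm_le.2 (norm_conjKernel_le b κ m z)
    · rw [← eLpNorm_two_sq]
      exact ENNReal.rpow_ne_top_of_nonneg two_pos.le (memLp_conjKernel hb hκ 0).2.ne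
    · have h1 : Filter.Tendsto (fun m : ℕ => conjKernel b κ m z) Filter.atTop (nhds 0) := by
        by_cases hz : z ∈ triangle
        · have h2 : Filter.Tendsto
              (fun m : ℕ => Complex.exp (-((z.1 : ℂ) - z.2)) ^ m) Filter.atTop (nhds 0) := by
            refine tendsto_pow_atTop_nhds_zero_of_norm_lt_one ?_
            rw [Complex.norm_exp]
            have h3 := hz.2.1
            simp only [Complex.neg_re, Complex.sub_re, Complex.ofReal_re, Real.exp_lt_one_iff]
            linarith
          have h3 := h2.mul_const (recip b z.1 * recip b z.2 * cut κ z)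
          rw [zero_mul] at h3
          refine h3.congr fun m => ?_
          rw [conjKernel, ← Complex.exp_nat_mul, mul_neg]
        · simp [conjKernel, cut, indicator_of_notMem hz]
      have h4 := ((ENNReal.continuous_rpow_const (y := 2)).tendsto _).comp h1.enorm
      simpa [Function.comp_def] using h4
  rw [lintegral_zero] at hlim
  obtain ⟨m, hm⟩ := (hlim.eventually (gt_mem_nhds one_pos)).exists
  refine ⟨m, ?_⟩
  rw [← eLpNorm_two_sq] at hm
  by_contra hge
  exact absurd hm (not_lt.2 (ENNReal.one_le_rpow (not_lt.1 hge) two_pos))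

lemma opB_sub_ae (hb : GoodWeight b) (hκ : GoodKernel b κ) {f g : ℝ → ℂ} (hf : MemWL2 b f)
    (hg : MemWL2 b g) :
    ∀ᵐ x ∂mu, opB b κ (fun x => f x - g x) x = opB b κ f x - opB b κ g x := by
  filter_upwards [hκ.ae_intervalIntegrable hb hf, hκ.ae_intervalIntegrable hb hg] with x h1 h2
  simp only [opB, mul_sub]
  rw [intervalIntegral.integral_sub h1 h2]
  ring

lemma opB_congr {f g : ℝ → ℂ} (h : f =ᵐ[mu] g) : opB b κ f =ᵐ[mu] opB b κ g := by
  filter_upwards [h, ae_mu_mem] with x hx hm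
  rw [opB, opB, hx, intervalIntegral_congr_ae_mu _ (by simp) (Ioo_subset_Icc_self hm)]
  filter_upwards [h] with t ht
  rw [ht]

lemma opB_memWL2 (hb : GoodWeight b) (hκ : GoodKernel b κ) {f : ℝ → ℂ} (hf : MemWL2 b f) :
    MemWL2 (recip b) (opB b κ f) := by
  refine MemWL2.add ⟨(hb.memLp.1.pow 2).mul hf.1, hf.2.ae_eq ?_⟩ (hκ.memWL2_integral hb hf)
  filter_upwards [hb.ne_zero] with x hx
  simp only [recip]
  field_simp

/-- Multiplication by e^{-mx} b on the source and by e^{-mx} / b on the target turns B into the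
identity plus the integral operator with kernel `conjKernel` on L₂. -/
lemma conj_opB (hb : GoodWeight b) (m : ℕ) (f : ℝ → ℂ) :
    ∀ᵐ x : ℝ ∂mu, Complex.exp (-(m * x)) * recip b x * opB b κ f x
      = Complex.exp (-(m * x)) * (b x * f x)
        + ∫ t : ℝ, conjKernel b κ m (x, t) * (Complex.exp (-(m * t)) * (b t * f t)) ∂mu := by
  filter_upwards [hb.ne_zero, ae_mu_mem] with x hx hm
  have e : ∫ t : ℝ, conjKernel b κ m (x, t) * (Complex.exp (-(m * t)) * (b t * f t)) ∂mu
      = Complex.exp (-(m * x)) * recip b x * ∫ t in (0 : ℝ)..x, κ x t * f t := by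
    rw [integral_kernel_eq f hm, ← integral_const_mul]
    refine integral_congr_ae ?_
    filter_upwards [hb.ne_zero] with t ht
    have e1 : Complex.exp (-(m * ((x : ℂ) - t))) * Complex.exp (-(m * t))
        = Complex.exp (-(m * x)) := by rw [← Complex.exp_add]; ring_nf
    have e2 : recip b t * b t = 1 := by simp [recip, ht]
    simp only [conjKernel, ← e1]
    linear_combination (Complex.exp (-(m * ((x : ℂ) - t))) * Complex.exp (-(m * t))
      * recip b x * cut κ (x, t) * f t) * e2
  have e2 : recip b x * b x = 1 := by simp [recip, hx]
  rw [e, opB]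
  linear_combination (Complex.exp (-(m * x)) * b x * f x) * e2

lemma bijective_opB (hb : GoodWeight b) (hκ : GoodKernel b κ) :
    BijectiveModAE (opB b κ) (MemWL2 b) (MemWL2 (recip b)) := by
  obtain ⟨m, hm⟩ := exists_eLpNorm_conjKernel_lt hb hκ
  have hk := memLp_conjKernel hb hκ m
  have hexp : ∀ c : ℂ, ContinuousOn (fun x : ℝ => Complex.exp (c * x)) (Icc 0 1) :=
    fun c => Continuous.continuousOn (by fun_prop)
  refine ⟨fun f hf => opB_memWL2 hb hκ hf, fun f g _ _ h => opB_congr h, ?_, ?_⟩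
  · intro f g hf hg h
    have hd := hf.sub hg
    have hF : MemLp (fun x : ℝ => Complex.exp (-(m * x)) * (b x * (f x - g x))) 2 mu := by
      have := (hd.mul_continuousOn hb (hexp (-m))).2
      refine this.ae_eq (Filter.Eventually.of_forall fun x => ?_)
      simp only [neg_mul]
      ring
    have h0 := ae_eq_zero_of_add_integral hk hm hF (by
      filter_upwards [conj_opB (κ := κ) hb m (fun x => f x - g x), opB_sub_ae hb hκ hf hg, h]
        with x h1 h2 h3
      rw [← h1, h2, h3, sub_self, mul_zero])
    filter_upwards [h0, hb.ne_zero] with x h1 h2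
    simpa [Complex.exp_ne_zero, h2, sub_eq_zero] using h1
  · intro h hh
    have hH : MemLp (fun x : ℝ => Complex.exp (-(m * x)) * recip b x * h x) 2 mu := by
      have := (hh.mul_continuousOn hb.recip (hexp (-m))).2
      refine this.ae_eq (Filter.Eventually.of_forall fun x => ?_)
      simp only [neg_mul]
      ring
    obtain ⟨F, hF, hFH⟩ := exists_add_integral_eq hk hm hH
    have h1 : MemWL2 b (fun x => recip b x * F x) := by
      refine ⟨hb.memLp_recip.1.mul hF.1, hF.ae_eq ?_⟩
      filter_upwards [hb.ne_zero] with x hx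
      simp only [recip]
      field_simp
    have h2 := h1.mul_continuousOn hb (hexp m)
    refine ⟨_, h2, ?_⟩
    have h3 : ∀ᵐ t : ℝ ∂mu, Complex.exp (-(m * (t : ℂ))) *
        (b t * (recip b t * F t * Complex.exp (m * t))) = F t := by
      filter_upwards [hb.ne_zero] with t ht
      have e1 : Complex.exp (-(m * (t : ℂ))) * Complex.exp (m * (t : ℂ)) = 1 := by
        rw [← Complex.exp_add]; simp
      have e2 : recip b t * b t = 1 := by simp [recip, ht]
      linear_combination (F t * recip b t * b t) * e1 + F t * e2
    filter_upwards [conj_opB (κ := κ) hb m _, hFH, h3, hb.recip.ne_zero] with x h4 h5 h6 h7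
    rw [h6, integral_congr_ae (g := fun t => conjKernel b κ m (x, t) * F t)
      (by filter_upwards [h3] with t ht; rw [ht]), h5] at h4
    exact mul_left_cancel₀ (mul_ne_zero (Complex.exp_ne_zero _) h7) h4

end Kernel

/-! ### Operations on kernels -/

section Kernel

variable {b : ℝ → ℂ} {κ κ₁ κ₂ : ℝ → ℝ → ℂ}

lemma GoodKernel.add (h₁ : GoodKernel b κ₁) (h₂ : GoodKernel b κ₂) :
    GoodKernel b (fun x t => κ₁ x t + κ₂ x t) where
  aesm := by
    have e : cut (fun x t => κ₁ x t + κ₂ x t) = cut κ₁ + cut κ₂ := indicator_add _ _ _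
    rw [e]
    exact h₁.aesm.add h₂.aesm
  bound := by
    obtain ⟨a₁, ha₁, hb₁⟩ := h₁.bound
    obtain ⟨a₂, ha₂, hb₂⟩ := h₂.bound
    refine ⟨fun x => a₁ x + a₂ x, by simpa only [Complex.ofReal_add] using ha₁.add ha₂,
      fun x t h0 h1 h2 => (norm_add_le _ _).trans ?_⟩
    have := hb₁ x t h0 h1 h2
    have := hb₂ x t h0 h1 h2
    linarith

lemma GoodKernel.const_mul (h : GoodKernel b κ) (c : ℂ) :
    GoodKernel b (fun x t => c * κ x t) where
  aesm := by
    have e : cut (fun x t => c * κ x t) = fun z => c * cut κ z := by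
      funext z
      by_cases hz : z ∈ triangle
      · simp only [cut, indicator_of_mem hz, Function.uncurry]
      · simp only [cut, indicator_of_notMem hz, mul_zero]
    rw [e]
    exact h.aesm.const_mul c
  bound := by
    obtain ⟨a, ha, hb⟩ := h.bound
    refine ⟨fun x => ‖c‖ * a x, by simpa only [Complex.ofReal_mul] using ha.const_mul _,
      fun x t h0 h1 h2 => ?_⟩
    rw [norm_mul, ← mul_add]
    exact mul_le_mul_of_nonneg_left (hb x t h0 h1 h2) (norm_nonneg c)

lemma GoodKernel.congr (h : GoodKernel b κ₁)
    (e : ∀ x t : ℝ, 0 < t → t < x → x < 1 → κ₁ x t = κ₂ x t) : GoodKernel b κ₂ where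
  aesm := by
    have : cut κ₂ = cut κ₁ := by
      funext z
      by_cases hz : z ∈ triangle
      · simp only [cut, indicator_of_mem hz, Function.uncurry, e _ _ hz.1 hz.2.1 hz.2.2]
      · simp only [cut, indicator_of_notMem hz]
    rw [this]
    exact h.aesm
  bound := by
    obtain ⟨a, ha, hb⟩ := h.bound
    exact ⟨a, ha, fun x t h0 h1 h2 => by rw [← e x t h0 h1 h2]; exact hb x t h0 h1 h2⟩

lemma goodKernel_zero (b : ℝ → ℂ) : GoodKernel b (fun _ _ => 0) where
  aesm := by
    have : cut (fun _ _ => 0) = fun _ => 0 := by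
      funext z
      simp [cut, indicator, Function.uncurry]
    rw [this]
    exact aestronglyMeasurable_const
  bound := ⟨fun _ => 0, by simpa using memWL2_zero _, fun _ _ _ _ _ => by simp⟩

/-- The kernel arising from the term `∫ σ φ^{(n-i)} y^{(n-j)}`. -/
def cauchyKernel (σ : ℝ → ℂ) : ℕ → ℕ → ℝ → ℝ → ℂ
  | 0, 0 => fun _ _ => 0
  | 0, j + 1 => fun x t => ((x : ℂ) - t) ^ j / (j.factorial : ℂ) * σ x
  | i + 1, 0 => fun x t => (-1) ^ (i + 1) * (((x : ℂ) - t) ^ i / (i.factorial : ℂ) * σ t)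
  | i + 1, j + 1 => fun x t => (-1) ^ (i + 1) * ∫ τ in t..x,
      ((x : ℂ) - τ) ^ i / (i.factorial : ℂ) * σ τ * (((τ : ℂ) - t) ^ j / (j.factorial : ℂ))

lemma norm_sub_pow_div_factorial_le {x t : ℝ} (h0 : 0 ≤ t) (h1 : t ≤ x) (h2 : x ≤ 1) (j : ℕ) :
    ‖((x : ℂ) - t) ^ j / (j.factorial : ℂ)‖ ≤ 1 := by
  rw [norm_div, norm_pow, ← Complex.ofReal_sub, Complex.norm_real, Complex.norm_natCast,
    Real.norm_of_nonneg (by linarith)]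
  have h3 : (x - t) ^ j ≤ 1 := pow_le_one₀ (by linarith) (by linarith)
  have h4 : (1 : ℝ) ≤ j.factorial := by exact_mod_cast j.factorial_pos
  exact div_le_one_of_le₀ (h3.trans h4) (by linarith)

lemma continuous_sub_pow_div_factorial (j : ℕ) :
    Continuous fun z : ℝ × ℝ => ((z.1 : ℂ) - z.2) ^ j / (j.factorial : ℂ) := by
  fun_prop

/-- On the triangle all powers over factorials are at most 1. Hence a = |σ| serves when exactly one
of i, j is zero, and the constant ∫ |σ| when both are positive. -/
lemma goodKernel_cauchyKernel (hb : GoodWeight b) {σ : ℝ → ℂ} (hσ : MemWL2 (recip b) σ)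
    (i j : ℕ) : GoodKernel b (cauchyKernel σ i j) := by
  have hn : ∀ x : ℝ, 0 ≤ ‖σ x‖ := fun x => norm_nonneg _
  match i, j with
  -- A default value: for i = j = 0 the operator is multiplication by σ, which has no kernel. Only i
  -- + j ≥ 1 occurs in the lower-order terms.
  | 0, 0 => exact goodKernel_zero b
  | 0, j + 1 =>
    refine ⟨AEStronglyMeasurable.indicator ?_ measurableSet_triangle,
      fun x => ‖σ x‖, hσ.norm hb.recip, fun x t h0 h1 h2 => ?_⟩
    · exact (continuous_sub_pow_div_factorial j).aestronglyMeasurable.mul hσ.1.comp_fst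
    · simp only [cauchyKernel]
      rw [norm_mul]
      have := mul_le_of_le_one_left (hn x) (norm_sub_pow_div_factorial_le h0.le h1.le h2.le j)
      linarith [hn t]
  | i + 1, 0 =>
    refine ⟨AEStronglyMeasurable.indicator ?_ measurableSet_triangle,
      fun x => ‖σ x‖, hσ.norm hb.recip, fun x t h0 h1 h2 => ?_⟩
    · exact ((continuous_sub_pow_div_factorial i).aestronglyMeasurable.mul
        hσ.1.comp_snd).const_mul _
    · simp only [cauchyKernel]
      rw [norm_mul, norm_mul, norm_pow, norm_neg, norm_one, one_pow, one_mul]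
      have := mul_le_of_le_one_left (hn t) (norm_sub_pow_div_factorial_le h0.le h1.le h2.le i)
      linarith [hn x]
  | i + 1, j + 1 =>
    have hi := hσ.integrable hb.recip
    refine ⟨?_, fun _ => ∫ τ, ‖σ τ‖ ∂mu, memWL2_const hb.recip _, fun x t h0 h1 h2 => ?_⟩
    · set s : Set ((ℝ × ℝ) × ℝ) := {w | w.1.2 < w.2 ∧ w.2 < w.1.1} with hs
      have hsm : MeasurableSet s :=
        (measurableSet_lt measurable_fst.snd measurable_snd).inter
          (measurableSet_lt measurable_snd measurable_fst.fst)
      have hm : AEStronglyMeasurable (fun w : (ℝ × ℝ) × ℝ => s.indicator (fun w =>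
          ((w.1.1 : ℂ) - w.2) ^ i / (i.factorial : ℂ) * σ w.2
            * (((w.2 : ℂ) - w.1.2) ^ j / (j.factorial : ℂ))) w) ((mu.prod mu).prod mu) := by
        refine AEStronglyMeasurable.indicator (AEStronglyMeasurable.mul
          (AEStronglyMeasurable.mul ?_ hσ.1.comp_snd) ?_) hsm
        · exact Continuous.aestronglyMeasurable (by fun_prop)
        · exact Continuous.aestronglyMeasurable (by fun_prop)
      refine ((hm.integral_prod_right'.const_mul ((-1) ^ (i + 1))).indicator
        measurableSet_triangle).congr (Filter.Eventually.of_forall fun z => ?_)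
      by_cases hz : z ∈ triangle
      · simp only [cut, indicator_of_mem hz, Function.uncurry, cauchyKernel]
        rw [intervalIntegral_eq_integral_mu hz.1.le hz.2.1.le hz.2.2.le]
        rfl
      · simp only [cut, indicator_of_notMem hz]
    · simp only [cauchyKernel]
      rw [norm_mul, norm_pow, norm_neg, norm_one, one_pow, one_mul,
        intervalIntegral_eq_integral_mu h0.le h1.le h2.le]
      have h3 : ‖∫ τ, (Ioo t x).indicator (fun τ : ℝ => ((x : ℂ) - τ) ^ i / (i.factorial : ℂ) * σ τ
          * (((τ : ℂ) - t) ^ j / (j.factorial : ℂ))) τ ∂mu‖ ≤ ∫ τ, ‖σ τ‖ ∂mu := by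
        refine norm_integral_le_of_norm_le hi.norm (Filter.Eventually.of_forall fun τ => ?_)
        by_cases hτ : τ ∈ Ioo t x
        · rw [indicator_of_mem hτ, norm_mul, norm_mul]
          have e1 := norm_sub_pow_div_factorial_le (h0.le.trans hτ.1.le) hτ.2.le h2.le i
          have e2 := norm_sub_pow_div_factorial_le h0.le hτ.1.le (hτ.2.le.trans h2.le) j
          exact mul_le_of_le_one_right (by positivity) e2 |>.trans
            (mul_le_of_le_one_left (hn τ) e1)
        · rw [indicator_of_notMem hτ, norm_zero]
          exact hn τ
      have : 0 ≤ ∫ τ, ‖σ τ‖ ∂mu := integral_nonneg hn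
      linarith

end Kernel

/-! ### Linearity of the iterated primitive -/

lemma intervalIntegrable_sub_pow_mul {f : ℝ → ℂ} (hf : Integrable f mu) (j : ℕ) {x : ℝ}
    (hx : x ∈ Icc (0 : ℝ) 1) : IntervalIntegrable
      (fun t : ℝ => ((x : ℂ) - t) ^ j / (j.factorial : ℂ) * f t) volume 0 x :=
  intervalIntegrable_of_mem
    (integrable_continuousOn_mul hf (Continuous.continuousOn (by fun_prop))) (by simp) hx

lemma volt_add {f g : ℝ → ℂ} (hf : Integrable f mu) (hg : Integrable g mu) (j : ℕ) {x : ℝ}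
    (hx : x ∈ Icc (0 : ℝ) 1) : volt j (fun x => f x + g x) x = volt j f x + volt j g x := by
  cases j with
  | zero => rfl
  | succ j =>
    simp only [volt, mul_add]
    exact intervalIntegral.integral_add (intervalIntegrable_sub_pow_mul hf j hx)
      (intervalIntegrable_sub_pow_mul hg j hx)

lemma volt_const_mul (c : ℂ) (f : ℝ → ℂ) (j : ℕ) (x : ℝ) :
    volt j (fun x => c * f x) x = c * volt j f x := by
  cases j with
  | zero => rfl
  | succ j =>
    simp only [volt, mul_left_comm _ c]
    exact intervalIntegral.integral_const_mul _ _

lemma volt_sum {ι : Type*} (s : Finset ι) {f : ι → ℝ → ℂ} (hf : ∀ i ∈ s, Integrable (f i) mu)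
    (j : ℕ) {x : ℝ} (hx : x ∈ Icc (0 : ℝ) 1) :
    volt j (fun x => ∑ i ∈ s, f i x) x = ∑ i ∈ s, volt j (f i) x := by
  cases j with
  | zero => rfl
  | succ j =>
    simp only [volt, Finset.mul_sum]
    exact intervalIntegral.integral_finsetSum fun i hi =>
      intervalIntegrable_sub_pow_mul (hf i hi) j hx

/-! ### Bilinear functionals represented by Volterra kernels -/

/-- The bilinear functional `Λ` has the form
`Λ(y,φ) = ∫ (∫₀ˣ κ(x,t) y^{(n)}(t) dt + ∑ y^{(ν)}(0) u_ν(x)) φ^{(n)}(x) dx`. -/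
structure Represents (b : ℝ → ℂ) (n : ℕ) (Λ : (ℝ → ℂ) → (ℝ → ℂ) → ℂ) (κ : ℝ → ℝ → ℂ) :
    Prop where
  good : GoodKernel b κ
  rep : ∃ u : ℕ → ℝ → ℂ, (∀ ν, MemWL2 (recip b) (u ν)) ∧
    ∀ y φ, MemW b n y → MemW0 b n φ → Λ y φ = ∫ x, ((∫ t in (0 : ℝ)..x, κ x t * der n y t)
      + opC n u y x) * der n φ x ∂mu

section Represents

variable {b : ℝ → ℂ} {n : ℕ} {Λ Λ₁ Λ₂ : (ℝ → ℂ) → (ℝ → ℂ) → ℂ} {κ κ₁ κ₂ : ℝ → ℝ → ℂ}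

lemma memWL2_opC {u : ℕ → ℝ → ℂ} (hu : ∀ ν < n, MemWL2 (recip b) (u ν)) (y : ℝ → ℂ) :
    MemWL2 (recip b) (opC n u y) :=
  MemWL2.sum _ fun ν hν => (hu ν (Finset.mem_range.1 hν)).const_mul _

lemma integrable_represents (hb : GoodWeight b) (hκ : GoodKernel b κ) {u : ℕ → ℝ → ℂ}
    (hu : ∀ ν, MemWL2 (recip b) (u ν)) {y φ : ℝ → ℂ} (hy : MemW b n y) (hφ : MemW b n φ) :
    Integrable (fun x => ((∫ t in (0 : ℝ)..x, κ x t * der n y t)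
      + opC n u y x) * der n φ x) mu :=
  ((hκ.memWL2_integral hb hy.2).add (memWL2_opC (fun ν _ => hu ν) y)).integrable_mul hb hφ.2

lemma Represents.add (hb : GoodWeight b) (h₁ : Represents b n Λ₁ κ₁)
    (h₂ : Represents b n Λ₂ κ₂) :
    Represents b n (fun y φ => Λ₁ y φ + Λ₂ y φ) (fun x t => κ₁ x t + κ₂ x t) := by
  obtain ⟨u₁, hu₁, e₁⟩ := h₁.rep
  obtain ⟨u₂, hu₂, e₂⟩ := h₂.rep
  refine ⟨h₁.good.add h₂.good, fun ν x => u₁ ν x + u₂ ν x, fun ν => (hu₁ ν).add (hu₂ ν), ?_⟩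
  intro y φ hy hφ
  rw [e₁ y φ hy hφ, e₂ y φ hy hφ, ← integral_add
    (integrable_represents hb h₁.good hu₁ hy hφ.1) (integrable_represents hb h₂.good hu₂ hy hφ.1)]
  refine integral_congr_ae ?_
  filter_upwards [h₁.good.ae_intervalIntegrable hb hy.2,
    h₂.good.ae_intervalIntegrable hb hy.2] with x i₁ i₂
  simp only [add_mul _ _ (der n y _), opC, mul_add, Finset.sum_add_distrib]
  rw [intervalIntegral.integral_add i₁ i₂]
  ring

lemma Represents.const_mul (h : Represents b n Λ κ) (c : ℂ) :
    Represents b n (fun y φ => c * Λ y φ) (fun x t => c * κ x t) := by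
  obtain ⟨u, hu, e⟩ := h.rep
  refine ⟨h.good.const_mul c, fun ν x => c * u ν x, fun ν => (hu ν).const_mul c, ?_⟩
  intro y φ hy hφ
  rw [e y φ hy hφ, ← integral_const_mul]
  refine integral_congr_ae (Filter.Eventually.of_forall fun x => ?_)
  simp only [mul_assoc c, opC, mul_left_comm _ c, ← Finset.mul_sum,
    intervalIntegral.integral_const_mul]
  ring

lemma represents_zero (b : ℝ → ℂ) (n : ℕ) :
    Represents b n (fun _ _ => 0) (fun _ _ => 0) :=
  ⟨goodKernel_zero b, fun _ _ => 0, fun _ => memWL2_zero _, fun y φ _ _ => by simp [opC]⟩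

lemma Represents.sum (hb : GoodWeight b) {ι : Type*} (s : Finset ι)
    {L : ι → (ℝ → ℂ) → (ℝ → ℂ) → ℂ} {k : ι → ℝ → ℝ → ℂ}
    (h : ∀ i ∈ s, Represents b n (L i) (k i)) :
    Represents b n (fun y φ => ∑ i ∈ s, L i y φ) (fun x t => ∑ i ∈ s, k i x t) := by
  classical
  induction s using Finset.induction_on with
  | empty => simpa using represents_zero b n
  | insert i s hi ih =>
    simp only [Finset.sum_insert hi]
    exact (h i (Finset.mem_insert_self _ _)).add hb
      (ih fun j hj => h j (Finset.mem_insert_of_mem hj))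

lemma Represents.congr_kernel (h : Represents b n Λ κ₁)
    (e : ∀ x t : ℝ, 0 < t → t < x → x < 1 → κ₁ x t = κ₂ x t) : Represents b n Λ κ₂ := by
  obtain ⟨u, hu, e'⟩ := h.rep
  refine ⟨h.good.congr e, u, hu, fun y φ hy hφ => ?_⟩
  rw [e' y φ hy hφ]
  refine integral_congr_ae ?_
  filter_upwards [ae_mu_mem] with x hx
  congr 2
  rw [intervalIntegral.integral_of_le hx.1.le, intervalIntegral.integral_of_le hx.1.le,
    integral_Ioc_eq_integral_Ioo, integral_Ioc_eq_integral_Ioo]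
  refine setIntegral_congr_fun measurableSet_Ioo fun t ht => ?_
  simp only [e x t ht.1 ht.2 hx.2]

/-- The bilinear functional `∫ σ φ^{(n-i)} y^{(n-j)}`. -/
def pairing (n : ℕ) (σ : ℝ → ℂ) (i j : ℕ) (y φ : ℝ → ℂ) : ℂ :=
  ∫ x, σ x * der (n - j) y x * der (n - i) φ x ∂mu

/-- Identifies `cauchyKernel` as the kernel of (-1)^i J^i σ J^j. When both i and j are positive, the
triangle swap merges the two integrations. -/
lemma volt_mul_volt (hb : GoodWeight b) {σ f : ℝ → ℂ} (hσ : MemWL2 (recip b) σ)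
    (hf : MemWL2 b f) {i j : ℕ} (hij : 1 ≤ i + j) {x : ℝ} (hx : x ∈ Icc (0 : ℝ) 1) :
    (-1) ^ i * volt i (fun x => σ x * volt j f x) x
      = ∫ t in (0 : ℝ)..x, cauchyKernel σ i j x t * f t := by
  match i, j with
  | 0, 0 => omega
  | 0, j + 1 =>
    simp only [volt, cauchyKernel, pow_zero, one_mul]
    rw [← intervalIntegral.integral_const_mul]
    refine intervalIntegral.integral_congr fun t _ => ?_
    ring
  | i + 1, 0 =>
    simp only [volt, cauchyKernel]
    rw [← intervalIntegral.integral_const_mul]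
    refine intervalIntegral.integral_congr fun t _ => ?_
    ring
  | i + 1, j + 1 =>
    have h1 : Integrable (fun τ : ℝ => ((x : ℂ) - τ) ^ i / (i.factorial : ℂ) * σ τ) mu :=
      integrable_continuousOn_mul (hσ.integrable hb.recip)
        (Continuous.continuousOn (by fun_prop))
    have h2 := integral_triangle_swap
      (w := fun τ t => ((τ : ℂ) - t) ^ j / (j.factorial : ℂ)) h1 (hf.integrable hb)
      (by unfold Function.uncurry; fun_prop) hx
    simp only [volt, cauchyKernel, mul_assoc ((-1 : ℂ) ^ (i + 1))]
    rw [intervalIntegral.integral_const_mul, ← h2]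
    simp only [mul_assoc]

lemma represents_pairing (hb : GoodWeight b) {σ : ℝ → ℂ} (hσ : MemWL2 (recip b) σ) {i j : ℕ}
    (hij : 1 ≤ i + j) (hi : i ≤ n) (hj : j ≤ n) :
    Represents b n (pairing n σ i j) (cauchyKernel σ i j) := by
  refine ⟨goodKernel_cauchyKernel hb hσ i j, ?_⟩
  have hσi := hσ.integrable hb.recip
  have hpow : ∀ m : ℕ, ContinuousOn (fun x : ℝ => (x : ℂ) ^ m / (m.factorial : ℂ)) (Icc 0 1) :=
    fun m => Continuous.continuousOn (by fun_prop)
  set v : ℕ → ℝ → ℂ := fun m x =>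
    (-1) ^ i * volt i (fun x : ℝ => σ x * ((x : ℂ) ^ m / (m.factorial : ℂ))) x with hv
  have hvm : ∀ m, MemWL2 (recip b) (v m) := by
    intro m
    refine MemWL2.const_mul ?_ _
    cases i with
    | zero => exact hσ.mul_continuousOn hb.recip (hpow m)
    | succ i =>
      exact memWL2_of_continuousOn hb.recip
        (continuousOn_volt_succ (integrable_mul_continuousOn hσi (hpow m)) i)
  -- The Taylor polynomial of y^{(n-j)} contains only the initial values of order n - j + m with m <
  -- j, so u_ν is the m-th contribution for ν = n - j + m and zero for smaller ν.
  refine ⟨fun ν x => if n - j ≤ ν then v (ν - (n - j)) x else 0, fun ν => ?_, ?_⟩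
  · by_cases h : n - j ≤ ν
    · simpa only [if_pos h] using hvm _
    · simpa only [if_neg h] using memWL2_zero _
  intro y φ hy hφ
  have hf := hy.2
  have hSi : Integrable (fun x => σ x * der (n - j) y x) mu :=
    hσ.integrable_mul hb (hy.memWL2_der hb (Nat.sub_le _ _))
  have h1 := hφ.integral_mul_der hb hSi (m := n - i) (i := i) (by omega)
  rw [Nat.sub_add_cancel hi] at h1
  rw [pairing, h1, ← integral_const_mul]
  refine integral_congr_ae ?_
  filter_upwards [ae_mu_mem] with x hx
  have hx := Ioo_subset_Icc_self hx
  have hσv : Integrable (fun x => σ x * volt j (der n y) x) mu := by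
    cases j with
    | zero => exact hσ.integrable_mul hb hf
    | succ j => exact integrable_mul_continuousOn hσi (continuousOn_volt_succ (hf.integrable hb) j)
  have hsum : ∀ m ∈ Finset.range j, Integrable (fun x : ℝ => der (n - j + m) y 0 *
      (σ x * ((x : ℂ) ^ m / (m.factorial : ℂ)))) mu :=
    fun m _ => (integrable_mul_continuousOn hσi (hpow m)).const_mul _
  have hS : ∀ x ∈ Icc (0 : ℝ) 1, σ x * der (n - j) y x =
      (∑ m ∈ Finset.range j, der (n - j + m) y 0 * (σ x * ((x : ℂ) ^ m / (m.factorial : ℂ))))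
        + σ x * volt j (der n y) x := by
    intro x hx
    rw [hy.der_eq_taylor hb hj hx, mul_add, Finset.mul_sum]
    congr 1
    exact Finset.sum_congr rfl fun m _ => by ring
  have hvolt : volt i (fun x => σ x * der (n - j) y x) x = volt i (fun x : ℝ =>
      (∑ m ∈ Finset.range j, der (n - j + m) y 0 * (σ x * ((x : ℂ) ^ m / (m.factorial : ℂ))))
        + σ x * volt j (der n y) x) x := by
    cases i with
    | zero => exact hS x hx
    | succ i =>
      refine volt_congr ?_ i hx
      filter_upwards [ae_mu_mem] with x hx using hS x (Ioo_subset_Icc_self hx)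
  have hC : opC n (fun ν x => if n - j ≤ ν then v (ν - (n - j)) x else 0) y x
      = ∑ m ∈ Finset.range j, der (n - j + m) y 0 * v m x := by
    have hn : n - j + j = n := Nat.sub_add_cancel hj
    simp only [opC]
    rw [← hn, Finset.sum_range_add, hn]
    rw [Finset.sum_eq_zero, zero_add]
    · refine Finset.sum_congr rfl fun m _ => ?_
      rw [if_pos (Nat.le_add_right _ _), Nat.add_sub_cancel_left]
    · intro ν hν
      rw [if_neg (by have := Finset.mem_range.1 hν; omega), mul_zero]
  rw [hC, hvolt, volt_add (integrable_finsetSum _ hsum) hσv i hx, volt_sum _ hsum i hx,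
    ← volt_mul_volt hb hσ hf hij hx]
  simp only [volt_const_mul, hv, mul_left_comm _ ((-1 : ℂ) ^ i), ← Finset.mul_sum]
  ring

end Represents

/-! ### The differential expression as a represented functional -/

section Ell

variable {b : ℝ → ℂ} {n : ℕ}

/-- Guarantees that an antiderivative of order k may be applied to the product. For k = 0, p + q ≥ 1
makes one of the two factors continuous. -/
lemma memW0_mul_der (hb : GoodWeight b) {y φ : ℝ → ℂ} (hy : MemW b n y) (hφ : MemW0 b n φ)
    {k p q : ℕ} (hkp : k + p ≤ n) (hkq : k + q ≤ n) (h1 : 1 ≤ k + p + q) :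
    MemW0 b k (fun x => der (n - (k + p)) φ x * der (n - (k + q)) y x) := by
  rcases Nat.eq_zero_or_pos k with rfl | hk
  · refine ⟨⟨fun j hj => absurd hj (Nat.not_lt_zero j), ?_⟩,
      fun j hj => absurd hj (Nat.not_lt_zero j)⟩
    rw [der_zero]
    rcases Nat.eq_zero_or_pos p with rfl | hp
    · exact (hφ.1.memWL2_der hb (Nat.sub_le _ _)).mul_continuousOn hb
        (hy.continuousOn (by omega))
    · simp only [mul_comm (der _ φ _)]
      exact (hy.memWL2_der hb (Nat.sub_le _ _)).mul_continuousOn hb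
        (hφ.1.continuousOn (by omega))
  · exact (hφ.der hb (by omega)).mul hb hk (hy.der hb (by omega))

/-- The numbers p and q count extra derivatives missing on φ and on y: (0, 0) for the terms with
p_k, and (0, 1), (1, 0) for the two halves of the terms with q_k. -/
lemma IsAntideriv.apply_mul_der (hb : GoodWeight b) {y φ : ℝ → ℂ} (hy : MemW b n y)
    (hφ : MemW0 b n φ) {k p q : ℕ} (hkp : k + p ≤ n) (hkq : k + q ≤ n) (h1 : 1 ≤ k + p + q)
    {σ : ℝ → ℂ} {f : Functional} (hf : IsAntideriv b k σ f) :
    f (fun x => der (n - (k + p)) φ x * der (n - (k + q)) y x)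
      = (-1) ^ k * ∑ ij ∈ Finset.HasAntidiagonal.antidiagonal k,
          (k.choose ij.1 : ℂ) * pairing n σ (p + ij.1) (q + ij.2) y φ := by
  rw [hf.2 _ (memW0_mul_der hb hy hφ hkp hkq h1), gDer, reg, intervalIntegral_zero_one]
  congr 1
  have hψ : MemW b k (der (n - (k + p)) φ) := hφ.1.der hb (by omega)
  have hη : MemW b k (der (n - (k + q)) y) := hy.der hb (by omega)
  have e : ∀ᵐ x ∂mu, σ x * der k (fun x => der (n - (k + p)) φ x * der (n - (k + q)) y x) x
      = ∑ ij ∈ Finset.HasAntidiagonal.antidiagonal k, (k.choose ij.1 : ℂ) *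
          (σ x * der (n - (q + ij.2)) y x * der (n - (p + ij.1)) φ x) := by
    filter_upwards [hψ.der_mul_ae hb hη] with x hx
    -- Leibniz' rule indexes by derivatives applied, the pairings by derivatives missing; since the
    -- two indices sum to k, the swap converts one into the other.
    rw [hx, leib, ← Finset.Nat.sum_antidiagonal_swap, Finset.mul_sum]
    refine Finset.sum_congr rfl fun ij hij => ?_
    rw [Finset.HasAntidiagonal.mem_antidiagonal] at hij
    simp only [Prod.fst_swap, Prod.snd_swap, der_der]
    rw [show ij.2 + (n - (k + p)) = n - (p + ij.1) by omega,
      show ij.1 + (n - (k + q)) = n - (q + ij.2) by omega,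
      ← Nat.choose_symm_of_eq_add hij.symm]
    ring
  rw [integral_congr_ae e, integral_finsetSum]
  · simp only [integral_const_mul, pairing]
  · intro ij hij
    rw [Finset.HasAntidiagonal.mem_antidiagonal] at hij
    refine Integrable.const_mul ?_ _
    by_cases h0 : p + ij.1 = 0
    · rw [h0]
      exact (hf.1.mul_continuousOn hb.recip (hy.continuousOn (by omega))).integrable_mul hb
        (hφ.1.memWL2_der hb (Nat.sub_le _ _))
    · have h2 := (hf.1.integrable_mul hb (hy.memWL2_der hb (j := n - (q + ij.2))
        (Nat.sub_le _ _)))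
      exact integrable_mul_continuousOn h2 (hφ.1.continuousOn (by omega))

/-- The sum of the lower order terms of the differential expression, for a family `T` of terms
indexed by a function and the numbers of derivatives missing on `φ` and on `y`. -/
def lowerSum (n : ℕ) (P Q : ℕ → ℝ → ℂ) (T : (ℝ → ℂ) → ℕ → ℕ → ℂ) : ℂ :=
  ∑ r ∈ Finset.range n,
    ((∑ ij ∈ Finset.HasAntidiagonal.antidiagonal (r + 1),
        ((r + 1).choose ij.1 : ℂ) * T (P (r + 1)) ij.1 ij.2)
      + Complex.I * ∑ ij ∈ Finset.HasAntidiagonal.antidiagonal r, (r.choose ij.1 : ℂ) *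
          (T (Q r) ij.1 (ij.2 + 1) + (-1) * T (Q r) (ij.1 + 1) ij.2))

lemma sum_Icc_one (r : ℕ) (h : ℕ → ℂ) :
    ∑ k ∈ Finset.Icc 1 r, h k = ∑ i ∈ Finset.range r, h (i + 1) := by
  induction r with
  | zero => simp
  | succ r ih => rw [Finset.sum_Icc_succ_top (by omega), ih, Finset.sum_range_succ]

lemma ell_eq (hb : GoodWeight b) {p₀ : ℝ → ℂ} {p q : ℕ → Functional} {P Q : ℕ → ℝ → ℂ}
    (hP : ∀ k, 1 ≤ k → k ≤ n → IsAntideriv b k (P k) (p k))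
    (hQ : ∀ k, k < n → IsAntideriv b k (Q k) (q k)) {y φ : ℝ → ℂ} (hy : MemW b n y)
    (hφ : MemW0 b n φ) :
    ell n p₀ p q y φ = (-1) ^ n * ((∫ x, p₀ x * der n y x * der n φ x ∂mu)
      + lowerSum n P Q (fun σ i j => pairing n σ i j y φ)) := by
  have hp : ∀ r ∈ Finset.range n,
      gDer (n - (r + 1)) (gMul (p (r + 1)) (der (n - (r + 1)) y)) φ
        = (-1) ^ n * ∑ ij ∈ Finset.HasAntidiagonal.antidiagonal (r + 1),
            ((r + 1).choose ij.1 : ℂ) * pairing n (P (r + 1)) ij.1 ij.2 y φ := by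
    intro r hr
    have hr := Finset.mem_range.1 hr
    have h := (hP (r + 1) (by omega) hr).apply_mul_der hb hy hφ (k := r + 1) (p := 0) (q := 0)
      (by omega) (by omega) (by omega)
    simp only [add_zero, zero_add] at h
    rw [gDer, gMul, h, ← mul_assoc, ← pow_add, Nat.sub_add_cancel hr]
  have hq : ∀ r ∈ Finset.range n,
      gDer (n - r) (gMul (q r) (der (n - r - 1) y)) φ
        + gDer (n - r - 1) (gMul (q r) (der (n - r) y)) φ
        = (-1) ^ n * ∑ ij ∈ Finset.HasAntidiagonal.antidiagonal r, (r.choose ij.1 : ℂ) *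
            (pairing n (Q r) ij.1 (ij.2 + 1) y φ
              + (-1) * pairing n (Q r) (ij.1 + 1) ij.2 y φ) := by
    intro r hr
    have hr := Finset.mem_range.1 hr
    have h1 := (hQ r hr).apply_mul_der hb hy hφ (k := r) (p := 0) (q := 1)
      (by omega) (by omega) (by omega)
    have h2 := (hQ r hr).apply_mul_der hb hy hφ (k := r) (p := 1) (q := 0)
      (by omega) (by omega) (by omega)
    simp only [add_zero, zero_add, add_comm 1] at h1 h2
    have e1 : ((-1 : ℂ) ^ (n - r)) * (-1) ^ r = (-1) ^ n := by
      rw [← pow_add, Nat.sub_add_cancel hr.le]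
    -- One outer derivative fewer than in the other half of the term: this is the origin of the
    -- minus sign between the two families of pairings with Q.
    have e2 : ((-1 : ℂ) ^ (n - (r + 1))) * (-1) ^ r = - (-1) ^ n := by
      have : ((-1 : ℂ) ^ (n - (r + 1))) * (-1) ^ (r + 1) = (-1) ^ n := by
        rw [← pow_add, Nat.sub_add_cancel hr]
      rw [← this]; ring
    rw [Nat.sub_sub, gDer, gDer, gMul, gMul, h1, h2, ← mul_assoc, ← mul_assoc, e1, e2]
    simp only [mul_add, Finset.sum_add_distrib, mul_left_comm _ (-1 : ℂ), ← Finset.mul_sum]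
    ring
  rw [ell, sum_Icc_one n (fun k => gDer (n - k) (gMul (p k) (der (n - k) y)) φ),
    Finset.sum_congr rfl hp, Finset.sum_congr rfl hq, gDer, reg, intervalIntegral_zero_one,
    lowerSum, Finset.sum_add_distrib]
  simp only [← Finset.mul_sum]
  ring

lemma represents_lowerSum (hb : GoodWeight b) {P Q : ℕ → ℝ → ℂ}
    (hP : ∀ k, 1 ≤ k → k ≤ n → MemWL2 (recip b) (P k))
    (hQ : ∀ k, k < n → MemWL2 (recip b) (Q k)) :
    Represents b n (fun y φ => lowerSum n P Q (fun σ i j => pairing n σ i j y φ))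
      (fun x t => lowerSum n P Q (fun σ i j => cauchyKernel σ i j x t)) := by
  unfold lowerSum
  refine Represents.sum hb _ fun r hr => ?_
  have hr := Finset.mem_range.1 hr
  refine Represents.add hb ?_ (Represents.const_mul ?_ _)
  · refine Represents.sum hb _ fun ij hij => Represents.const_mul ?_ _
    rw [Finset.HasAntidiagonal.mem_antidiagonal] at hij
    exact represents_pairing hb (hP (r + 1) (by omega) hr) (by omega) (by omega) (by omega)
  · refine Represents.sum hb _ fun ij hij => Represents.const_mul ?_ _
    rw [Finset.HasAntidiagonal.mem_antidiagonal] at hij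
    exact (represents_pairing hb (hQ r hr) (by omega) (by omega) (by omega)).add hb
      ((represents_pairing hb (hQ r hr) (by omega) (by omega) (by omega)).const_mul _)

/-! ### Identification of the kernel -/

/-- Summation by parts; it produces the differences of consecutive binomial coefficients in the
kernel formula. -/
lemma sum_choose_mul_sub (r : ℕ) (F : ℕ → ℂ) :
    ∑ c ∈ Finset.range (r + 1), (r.choose c : ℂ) * (F c + (-1) * F (c + 1))
      = F 0 + (∑ i ∈ Finset.range r,
          ((r.choose (i + 1) : ℂ) - (r.choose i : ℂ)) * F (i + 1)) - F (r + 1) := by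
  have h1 : ∑ c ∈ Finset.range (r + 1), (r.choose c : ℂ) * F c
      = (∑ i ∈ Finset.range r, (r.choose (i + 1) : ℂ) * F (i + 1)) + F 0 := by
    rw [Finset.sum_range_succ']; simp
  have h2 : ∑ c ∈ Finset.range (r + 1), (r.choose c : ℂ) * F (c + 1)
      = (∑ i ∈ Finset.range r, (r.choose i : ℂ) * F (i + 1)) + F (r + 1) := by
    rw [Finset.sum_range_succ]; simp
  simp only [mul_add, Finset.sum_add_distrib, mul_left_comm _ (-1 : ℂ), ← Finset.mul_sum, sub_mul,
    Finset.sum_sub_distrib, h1, h2]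
  ring

lemma cauchyKernel_combination {σ ρ : ℝ → ℂ} (hσ : Integrable σ mu) (hρ : Integrable ρ mu)
    (α β : ℂ) (i j : ℕ) {x t : ℝ} (hx : x ∈ Icc (0 : ℝ) 1) (ht : t ∈ Icc (0 : ℝ) 1) :
    α * cauchyKernel σ (i + 1) (j + 1) x t + β * cauchyKernel ρ (i + 1) (j + 1) x t
      = (-1) ^ (i + 1) * ∫ τ in t..x, ((x : ℂ) - τ) ^ i / (i.factorial : ℂ)
          * (α * σ τ + β * ρ τ) * (((τ : ℂ) - t) ^ j / (j.factorial : ℂ)) := by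
  have hint : ∀ {s : ℝ → ℂ}, Integrable s mu → IntervalIntegrable (fun τ : ℝ =>
      ((x : ℂ) - τ) ^ i / (i.factorial : ℂ) * s τ
        * (((τ : ℂ) - t) ^ j / (j.factorial : ℂ))) volume t x := fun hs =>
    intervalIntegrable_of_mem (integrable_mul_continuousOn (integrable_continuousOn_mul hs
      (Continuous.continuousOn (by fun_prop))) (Continuous.continuousOn (by fun_prop))) ht hx
  simp only [cauchyKernel]
  rw [mul_left_comm α, mul_left_comm β, ← mul_add, ← intervalIntegral.integral_const_mul,
    ← intervalIntegral.integral_const_mul,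
    ← intervalIntegral.integral_add ((hint hσ).const_mul α) ((hint hρ).const_mul β)]
  congr 1
  refine intervalIntegral.integral_congr fun τ _ => ?_
  ring

lemma lowerSum_eq_kernel {P Q : ℕ → ℝ → ℂ} (hP : ∀ k, 1 ≤ k → k ≤ n → Integrable (P k) mu)
    (hQ : ∀ k, k < n → Integrable (Q k) mu) {x t : ℝ} (h0 : 0 < t) (h1 : t < x) (h2 : x < 1) :
    lowerSum n P Q (fun σ i j => cauchyKernel σ i j x t) = kernel n P Q x t := by
  have hx : x ∈ Icc (0 : ℝ) 1 := ⟨(h0.trans h1).le, h2.le⟩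
  have ht : t ∈ Icc (0 : ℝ) 1 := ⟨h0.le, (h1.trans h2).le⟩
  rw [kernel, sum_Icc_one n]
  refine Finset.sum_congr rfl fun r hr => ?_
  have hr := Finset.mem_range.1 hr
  simp only [Nat.add_sub_cancel]
  rw [sum_Icc_one r]
  -- The two extreme indices carry σ(x) and σ(t) outside any integral; the interior ones are the
  -- integrals over (t, x).
  have eP : ∑ ij ∈ Finset.HasAntidiagonal.antidiagonal (r + 1),
      ((r + 1).choose ij.1 : ℂ) * cauchyKernel (P (r + 1)) ij.1 ij.2 x t
      = cauchyKernel (P (r + 1)) 0 (r + 1) x t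
        + (∑ i ∈ Finset.range r, ((r + 1).choose (i + 1) : ℂ)
          * cauchyKernel (P (r + 1)) (i + 1) (r + 1 - (i + 1)) x t)
        + cauchyKernel (P (r + 1)) (r + 1) 0 x t := by
    rw [Finset.Nat.sum_antidiagonal_eq_sum_range_succ (fun i j =>
      ((r + 1).choose i : ℂ) * cauchyKernel (P (r + 1)) i j x t), Finset.sum_range_succ',
      Finset.sum_range_succ]
    simp
    ring
  have eQ : ∑ ij ∈ Finset.HasAntidiagonal.antidiagonal r, (r.choose ij.1 : ℂ) *
      (cauchyKernel (Q r) ij.1 (ij.2 + 1) x t + (-1) * cauchyKernel (Q r) (ij.1 + 1) ij.2 x t)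
      = cauchyKernel (Q r) 0 (r + 1) x t
        + (∑ i ∈ Finset.range r, ((r.choose (i + 1) : ℂ) - (r.choose i : ℂ))
          * cauchyKernel (Q r) (i + 1) (r + 1 - (i + 1)) x t)
        - cauchyKernel (Q r) (r + 1) 0 x t := by
    have h := sum_choose_mul_sub r (fun ν => cauchyKernel (Q r) ν (r + 1 - ν) x t)
    simp only [Nat.sub_zero, Nat.sub_self] at h
    rw [← h, Finset.Nat.sum_antidiagonal_eq_sum_range_succ (fun i j => (r.choose i : ℂ) *
      (cauchyKernel (Q r) i (j + 1) x t + (-1) * cauchyKernel (Q r) (i + 1) j x t))]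
    refine Finset.sum_congr rfl fun i hi => ?_
    have hi := Finset.mem_range.1 hi
    rw [show r + 1 - i = r - i + 1 by omega, show r + 1 - (i + 1) = r - i by omega]
  have eM : ∀ i ∈ Finset.range r,
      ((r + 1).choose (i + 1) : ℂ) * cauchyKernel (P (r + 1)) (i + 1) (r + 1 - (i + 1)) x t
        + Complex.I * (((r.choose (i + 1) : ℂ) - (r.choose i : ℂ))
          * cauchyKernel (Q r) (i + 1) (r + 1 - (i + 1)) x t)
      = (-1) ^ (i + 1) * ∫ τ in t..x, ((x : ℂ) - τ) ^ (i + 1 - 1) / ((i + 1 - 1).factorial : ℂ)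
          * (((r + 1).choose (i + 1) : ℂ) * P (r + 1) τ
            + Complex.I * ((r.choose (i + 1) : ℂ) - (r.choose (i + 1 - 1) : ℂ)) * Q r τ)
          * (((τ : ℂ) - t) ^ (r - (i + 1)) / ((r - (i + 1)).factorial : ℂ)) := by
    intro i hi
    have hi := Finset.mem_range.1 hi
    rw [show r + 1 - (i + 1) = (r - (i + 1)) + 1 by omega, ← mul_assoc Complex.I,
      cauchyKernel_combination (hP (r + 1) (by omega) hr) (hQ r hr) _ _ _ _ hx ht]
    rfl
  rw [eP, eQ, ← Finset.sum_congr rfl eM, Finset.sum_add_distrib, ← Finset.mul_sum]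
  simp only [cauchyKernel]
  ring

lemma represents_kernel (hb : GoodWeight b) {P Q : ℕ → ℝ → ℂ}
    (hP : ∀ k, 1 ≤ k → k ≤ n → MemWL2 (recip b) (P k))
    (hQ : ∀ k, k < n → MemWL2 (recip b) (Q k)) :
    Represents b n (fun y φ => lowerSum n P Q (fun σ i j => pairing n σ i j y φ))
      (kernel n P Q) :=
  (represents_lowerSum hb hP hQ).congr_kernel fun _ _ h0 h1 h2 =>
    lowerSum_eq_kernel (fun k h1 hk => (hP k h1 hk).integrable hb.recip)
      (fun k hk => (hQ k hk).integrable hb.recip) h0 h1 h2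

end Ell

/-! ### Uniqueness of the representing kernel -/

/-- Rectangles form a π-system generating the product σ-algebra, and the sets with zero integral are
closed under complements and disjoint countable unions. -/
lemma ae_eq_zero_of_setIntegral_prod {G : ℝ × ℝ → ℂ} (hG : Integrable G (mu.prod mu))
    (h : ∀ A B : Set ℝ, MeasurableSet A → MeasurableSet B →
      ∫ z in A ×ˢ B, G z ∂mu.prod mu = 0) : G =ᵐ[mu.prod mu] 0 := by
  refine hG.ae_eq_zero_of_forall_setIntegral_eq_zero fun s hs _ => ?_
  induction s, hs using MeasurableSpace.induction_on_inter generateFrom_prod.symm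
    isPiSystem_prod with
  | empty => simp
  | basic t ht =>
    obtain ⟨A, hA, B, hB, rfl⟩ := ht
    exact h A B hA hB
  | compl t ht ih =>
    have h1 := integral_add_compl ht hG
    have h2 := h univ univ MeasurableSet.univ MeasurableSet.univ
    rw [univ_prod_univ, setIntegral_univ] at h2
    rwa [ih (measure_lt_top _ _), zero_add, h2] at h1
  | iUnion f hd hm ih =>
    rw [integral_iUnion hm hd hG.integrableOn]
    simp [ih _ (measure_lt_top _ _)]

lemma eq_zero_of_sum_pow_eq_zero {n : ℕ} {v : Fin n → ℂ} {s : ℝ} (hs : 0 < s)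
    (h : ∀ x ∈ Ioo (0 : ℝ) s, ∑ i, v i * (1 - (x : ℂ)) ^ (i : ℕ) = 0) : v = 0 := by
  set P : Polynomial ℂ := ∑ i : Fin n, Polynomial.C (v i) * Polynomial.X ^ (i : ℕ) with hP
  have hroot : P = 0 := by
    refine Polynomial.eq_zero_of_infinite_isRoot P ?_
    have hinj : Function.Injective fun x : ℝ => (1 : ℂ) - x := fun x y hxy => by
      simpa using hxy
    refine ((Ioo_infinite hs).image hinj.injOn).mono ?_
    rintro _ ⟨x, hx, rfl⟩
    have := h x hx
    simpa [P, Polynomial.IsRoot, Polynomial.eval_finsetSum] using this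
  funext i
  have h1 : P.coeff (i : ℕ) = v i := by
    simp only [hP, Polynomial.finsetSum_coeff, Polynomial.coeff_C_mul_X_pow]
    rw [Finset.sum_eq_single i]
    · simp
    · intro j _ hj
      rw [if_neg fun h => hj (Fin.ext h.symm)]
    · simp
  rw [← h1, hroot]
  simp

/-- Moments with respect to powers of `1 - x` on `(0,s)` can be prescribed. -/
lemma exists_moments {s : ℝ} (hs : 0 < s) (n : ℕ) (c : Fin n → ℂ) :
    ∃ p : ℝ → ℂ, Continuous p ∧
      ∀ i : Fin n, ∫ x in (0 : ℝ)..s, (1 - (x : ℂ)) ^ (i : ℕ) * p x = c i := by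
  set p : (Fin n → ℂ) → ℝ → ℂ := fun v x => ∑ j, v j * (1 - (x : ℂ)) ^ (j : ℕ) with hp
  have hpc : ∀ v, Continuous (p v) := fun v => by fun_prop
  have hint : ∀ (i : Fin n) (v : Fin n → ℂ), IntervalIntegrable
      (fun x : ℝ => (1 - (x : ℂ)) ^ (i : ℕ) * p v x) volume 0 s := fun i v =>
    Continuous.intervalIntegrable (by have := hpc v; fun_prop) _ _
  set L : (Fin n → ℂ) →ₗ[ℂ] (Fin n → ℂ) :=
    { toFun := fun v i => ∫ x in (0 : ℝ)..s, (1 - (x : ℂ)) ^ (i : ℕ) * p v x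
      map_add' := fun v w => by
        funext i
        rw [Pi.add_apply, ← intervalIntegral.integral_add (hint i v) (hint i w)]
        refine intervalIntegral.integral_congr fun x _ => ?_
        simp only [hp, Pi.add_apply, add_mul, Finset.sum_add_distrib, mul_add]
      map_smul' := fun a v => by
        funext i
        simp only [Pi.smul_apply, smul_eq_mul, RingHom.id_apply]
        rw [← intervalIntegral.integral_const_mul]
        refine intervalIntegral.integral_congr fun x _ => ?_
        simp only [hp, Pi.smul_apply, smul_eq_mul, mul_assoc, ← Finset.mul_sum]
        ring } with hL
  -- The matrix of `L` is the Gram matrix of the powers of 1 - x on (0, s): if all moments of the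
  -- polynomial p_v vanish, then ∫ |p_v|² = 0, so v = 0.
  have hinj : Function.Injective L := by
    rw [injective_iff_map_eq_zero]
    intro v hv
    have h1 : ∫ x in (0 : ℝ)..s, ((‖p v x‖ ^ 2 : ℝ) : ℂ) = 0 := by
      have h2 : ∀ x : ℝ, ((‖p v x‖ ^ 2 : ℝ) : ℂ)
          = ∑ i, (starRingEnd ℂ) (v i) * ((1 - (x : ℂ)) ^ (i : ℕ) * p v x) := by
        intro x
        rw [Complex.ofReal_pow, ← Complex.conj_mul']
        simp only [← mul_assoc, ← Finset.sum_mul]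
        congr 1
        simp [hp, map_sum, Complex.conj_ofReal]
      simp only [h2]
      rw [intervalIntegral.integral_finsetSum fun i _ => (hint i v).const_mul _]
      refine Finset.sum_eq_zero fun i _ => ?_
      rw [intervalIntegral.integral_const_mul]
      have h3 : ∫ x in (0 : ℝ)..s, (1 - (x : ℂ)) ^ (i : ℕ) * p v x = 0 := congrFun hv i
      rw [h3, mul_zero]
    rw [intervalIntegral.integral_ofReal, Complex.ofReal_eq_zero] at h1
    have hc : Continuous fun x => ‖p v x‖ ^ 2 := ((hpc v).norm).pow 2
    refine eq_zero_of_sum_pow_eq_zero hs fun x hx => ?_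
    by_contra hne
    have h4 : 0 < ∫ x in (0 : ℝ)..s, ‖p v x‖ ^ 2 :=
      intervalIntegral.integral_pos hs hc.continuousOn (fun _ _ => by positivity)
        ⟨x, Ioo_subset_Icc_self hx, pow_pos (norm_pos_iff.2 hne) 2⟩
    exact h4.ne' h1
  obtain ⟨v, hv⟩ := (LinearMap.injective_iff_surjective.1 hinj) c
  exact ⟨p v, hpc v, fun i => congrFun hv i⟩

section Uniqueness

variable {b : ℝ → ℂ} {n : ℕ}

lemma der_volt_zero {f : ℝ → ℂ} (hf : Integrable f mu) {j : ℕ} (hj : j < n) :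
    der j (volt n f) 0 = 0 := by
  obtain ⟨m, rfl⟩ : ∃ m, n = j + (m + 1) := ⟨n - j - 1, by omega⟩
  rw [der_volt hf j m (by simp)]
  exact intervalIntegral.integral_same

/-- The derivatives of J^n g at 1 are, up to factorials, the moments of g against powers of 1 - x,
while those at 0 vanish automatically. -/
lemma memW0_volt (hb : GoodWeight b) {g : ℝ → ℂ} (hg : MemWL2 b g)
    (h : ∀ i < n, ∫ x, (1 - (x : ℂ)) ^ i * g x ∂mu = 0) : MemW0 b n (volt n g) := by
  have hi := hg.integrable hb
  refine ⟨memW_volt hb hg n, fun j hj => ⟨der_volt_zero hi hj, ?_⟩⟩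
  obtain ⟨m, rfl⟩ : ∃ m, n = j + (m + 1) := ⟨n - j - 1, by omega⟩
  rw [der_volt hi j m (by simp)]
  simp only [volt]
  rw [intervalIntegral_zero_one]
  have e : ∀ x : ℝ, (((1 : ℝ) : ℂ) - x) ^ m / (m.factorial : ℂ) * g x
      = (m.factorial : ℂ)⁻¹ * ((1 - (x : ℂ)) ^ m * g x) := by
    intro x; push_cast; ring
  simp only [e]
  rw [integral_const_mul, h m (by omega), mul_zero]

/-- Tested with y = J^n f and φ = J^n g: all initial values of y vanish, so the functions u_ν drop
out and only the kernel is seen. -/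
lemma Represents.integral_eq_zero (hb : GoodWeight b) {D : ℝ → ℝ → ℂ}
    (hD : Represents b n (fun _ _ => 0) D) {f g : ℝ → ℂ} (hf : MemWL2 b f) (hg : MemWL2 b g)
    (h : ∀ i < n, ∫ x, (1 - (x : ℂ)) ^ i * g x ∂mu = 0) :
    ∫ x, (∫ t, cut D (x, t) * f t ∂mu) * g x ∂mu = 0 := by
  obtain ⟨u, -, e⟩ := hD.rep
  have hfi := hf.integrable hb
  rw [e _ _ (memW_volt hb hf n) (memW0_volt hb hg h)]
  refine integral_congr_ae ?_
  filter_upwards [ae_mu_mem, der_volt_self (hg.integrable hb) n] with x hx hgx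
  rw [hgx, integral_kernel_eq _ hx, opC, Finset.sum_eq_zero, add_zero]
  · congr 1
    refine integral_congr_ae ?_
    filter_upwards [der_volt_self hfi n] with t ht
    rw [ht]
  · intro ν hν
    rw [der_volt_zero hfi (Finset.mem_range.1 hν), zero_mul]

lemma Represents.cut_ae_eq_zero (hb : GoodWeight b) {D : ℝ → ℝ → ℂ}
    (hD : Represents b n (fun _ _ => 0) D) : cut D =ᵐ[mu.prod mu] 0 := by
  have hDi := hD.good.integrable_cut hb
  have key : ∀ s ∈ Ioo (0 : ℝ) 1,
      ({z : ℝ × ℝ | s < z.2}).indicator (cut D) =ᵐ[mu.prod mu] 0 := by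
    intro s hs
    have hsm : MeasurableSet {z : ℝ × ℝ | s < z.2} :=
      measurableSet_lt measurable_const measurable_snd
    refine ae_eq_zero_of_setIntegral_prod (hDi.indicator hsm) fun B A hB hA => ?_
    set f : ℝ → ℂ := (A ∩ Ioi s).indicator fun _ => 1 with hf
    have hAm : MeasurableSet (A ∩ Ioi s) := hA.inter measurableSet_Ioi
    have hBm : MeasurableSet (B ∩ Ici s) := hB.inter measurableSet_Ici
    have hone : ∀ {C : Set ℝ}, MeasurableSet C → MemWL2 b (C.indicator fun _ => (1 : ℂ)) := by
      intro C hC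
      refine memWL2_of_bounded hb (aestronglyMeasurable_const.indicator hC) (C := 1)
        (Filter.Eventually.of_forall fun x => ?_)
      exact (norm_indicator_le_norm_self _ _).trans (by simp)
    obtain ⟨p, hpc, hp⟩ := exists_moments hs.1 n
      (fun i => -∫ x, (1 - (x : ℂ)) ^ (i : ℕ) * (B ∩ Ici s).indicator (fun _ => 1) x ∂mu)
    -- The polynomial part on (0, s) cancels the moments of the indicator and makes g admissible.
    set g : ℝ → ℂ := fun x => (B ∩ Ici s).indicator (fun _ => 1) x + (Iio s).indicator p x with hg
    have hpm : MemWL2 b ((Iio s).indicator p) := by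
      obtain ⟨C, hC⟩ := exists_bound_of_continuousOn hpc.continuousOn
      refine memWL2_of_bounded hb (hpc.aestronglyMeasurable.indicator measurableSet_Iio)
        (C := C) ?_
      filter_upwards [hC] with x hx using (norm_indicator_le_norm_self _ _).trans hx
    have hgm : MemWL2 b g := (hone hBm).add hpm
    have hmom : ∀ i < n, ∫ x, (1 - (x : ℂ)) ^ i * g x ∂mu = 0 := by
      intro i hi
      have hpow : ContinuousOn (fun x : ℝ => (1 - (x : ℂ)) ^ i) (Icc 0 1) :=
        Continuous.continuousOn (by fun_prop)
      have h1 := hp ⟨i, hi⟩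
      rw [intervalIntegral_zero_left (Ioo_subset_Icc_self hs)] at h1
      simp only [hg, mul_add]
      rw [integral_add (integrable_continuousOn_mul ((hone hBm).integrable hb) hpow)
        (integrable_continuousOn_mul (hpm.integrable hb) hpow)]
      simp only [indicator_mul_right] at h1
      rw [h1, add_neg_cancel]
    have h0 := hD.integral_eq_zero hb (hone hAm) hgm hmom
    rw [setIntegral_prod _ (hDi.indicator hsm).integrableOn, ← integral_indicator hB, ← h0]
    refine integral_congr_ae (Filter.Eventually.of_forall fun x => ?_)
    have e : ∫ t in A, ({z : ℝ × ℝ | s < z.2}).indicator (cut D) (x, t) ∂mu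
        = ∫ t, cut D (x, t) * f t ∂mu := by
      rw [← integral_indicator hA]
      refine integral_congr_ae (Filter.Eventually.of_forall fun t => ?_)
      by_cases h1 : t ∈ A <;> by_cases h2 : s < t <;> simp [hf, indicator, h1, h2]
    by_cases hxs : x < s
    -- For x < s the support t > s of f lies outside the triangle, so the correction term
    -- contributes nothing.
    · have hz : ∫ t, cut D (x, t) * f t ∂mu = 0 := by
        refine integral_eq_zero_of_ae (Filter.Eventually.of_forall fun t => ?_)
        by_cases ht : s < t
        · have : (x, t) ∉ triangle := fun hm => by
            have := hm.2.1; simp only at this; linarith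
          simp [cut, indicator_of_notMem this]
        · simp [hf, ht]
      change B.indicator _ x = (∫ t, cut D (x, t) * f t ∂mu) * g x
      rw [hz, zero_mul]
      by_cases hxB : x ∈ B
      · rw [indicator_of_mem hxB, e, hz]
      · rw [indicator_of_notMem hxB]
    · by_cases hxB : x ∈ B
      · simp only [indicator_of_mem hxB, e, hg]
        rw [indicator_of_mem (show x ∈ B ∩ Ici s from ⟨hxB, not_lt.1 hxs⟩),
          indicator_of_notMem (show x ∉ Iio s from hxs), add_zero, mul_one]
      · simp only [indicator_of_notMem hxB, hg]
        rw [indicator_of_notMem (show x ∉ B ∩ Ici s from fun h => hxB h.1),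
          indicator_of_notMem (show x ∉ Iio s from hxs), add_zero, mul_zero]
  -- A countable sequence of s tending to 0 exhausts t > 0; the shift by 2 keeps 1 / (m + 2)
  -- strictly below 1.
  have hall : ∀ᵐ z ∂mu.prod mu, ∀ m : ℕ,
      ({z : ℝ × ℝ | 1 / ((m : ℝ) + 2) < z.2}).indicator (cut D) z = 0 := by
    rw [ae_all_iff]
    intro m
    refine key _ ⟨by positivity, ?_⟩
    rw [div_lt_one (by positivity)]
    have : (0 : ℝ) ≤ m := Nat.cast_nonneg m
    linarith
  filter_upwards [hall] with z hz
  by_cases hm : z ∈ triangle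
  · obtain ⟨m, hm1⟩ := exists_nat_one_div_lt hm.1
    have h1 : 1 / ((m : ℝ) + 2) < z.2 := by
      refine lt_of_le_of_lt ?_ hm1
      exact one_div_le_one_div_of_le (by positivity) (by linarith)
    have h2 := hz m
    rwa [indicator_of_mem (show z ∈ {z : ℝ × ℝ | 1 / ((m : ℝ) + 2) < z.2} from h1)] at h2
  · simp [cut, indicator_of_notMem hm]

lemma Represents.kernel_unique (hb : GoodWeight b) {Λ₁ Λ₂ : (ℝ → ℂ) → (ℝ → ℂ) → ℂ}
    {κ₁ κ₂ : ℝ → ℝ → ℂ} (h₁ : Represents b n Λ₁ κ₁) (h₂ : Represents b n Λ₂ κ₂)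
    (h : ∀ y φ, MemW b n y → MemW0 b n φ → Λ₁ y φ = Λ₂ y φ) :
    ∀ᵐ z ∂((volume : Measure (ℝ × ℝ)).restrict triangle), κ₁ z.1 z.2 = κ₂ z.1 z.2 := by
  have h3 := h₁.add hb (h₂.const_mul (-1))
  obtain ⟨u, hu, e⟩ := h3.rep
  have h4 : Represents b n (fun _ _ => 0) (fun x t => κ₁ x t + (-1) * κ₂ x t) :=
    ⟨h3.good, u, hu, fun y φ hy hφ => by rw [← e y φ hy hφ, h y φ hy hφ]; ring⟩
  rw [← restrict_triangle, ae_restrict_iff' measurableSet_triangle]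
  filter_upwards [h4.cut_ae_eq_zero hb] with z hz hm
  rw [cut, indicator_of_mem hm] at hz
  simp only [Function.uncurry, Pi.zero_apply] at hz
  linear_combination hz

lemma ell_eq_gDer_opB (hb : GoodWeight b) {p₀ : ℝ → ℂ} (hbp : ∀ᵐ x ∂mu, b x ^ 2 = p₀ x)
    {v : ℂ} {κ : ℝ → ℝ → ℂ} (hκ : GoodKernel b κ) {u : ℕ → ℝ → ℂ}
    (hu : ∀ ν, MemWL2 (recip b) (u ν)) {y φ : ℝ → ℂ} (hy : MemW b n y) (hφ : MemW0 b n φ)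
    (e : v = ∫ x, ((∫ t in (0 : ℝ)..x, κ x t * der n y t) + opC n u y x) * der n φ x ∂mu) :
    (-1) ^ n * ((∫ x, p₀ x * der n y x * der n φ x ∂mu) + v)
      = gDer n (reg (fun x => opB b κ (der n y) x + opC n u y x)) φ := by
  rw [gDer, reg, intervalIntegral_zero_one, e]
  have h1 : MemWL2 (recip b) (fun x => b x ^ 2 * der n y x) := by
    refine ⟨(hb.memLp.1.pow 2).mul hy.2.1, hy.2.2.ae_eq ?_⟩
    filter_upwards [hb.ne_zero] with x hx
    simp only [recip]
    field_simp
  have h2 : ∫ x, p₀ x * der n y x * der n φ x ∂mu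
      = ∫ x, b x ^ 2 * der n y x * der n φ x ∂mu := by
    refine integral_congr_ae ?_
    filter_upwards [hbp] with x hx
    rw [hx]
  rw [h2, ← integral_add (h1.integrable_mul hb hφ.1.2) (integrable_represents hb hκ hu hy hφ.1)]
  congr 1
  refine integral_congr_ae (Filter.Eventually.of_forall fun x => ?_)
  simp only [opB]
  ring

end Uniqueness

end SingExpr

end

/-! ### Proof of the theorem -/

theorem mainTheorem3 (n : ℕ) (hn : 1 ≤ n)
    (p₀ b : ℝ → ℂ) (p q : ℕ → SingExpr.Functional)
    (hp₀ : Integrable p₀ SingExpr.mu)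
    (hp₀_ne : ∀ᵐ x ∂SingExpr.mu, p₀ x ≠ 0)
    (hp₀_inv : Integrable (fun x => 1 / p₀ x) SingExpr.mu)
    (hb_meas : AEStronglyMeasurable b SingExpr.mu)
    (hb : ∀ᵐ x ∂SingExpr.mu, b x ^ 2 = p₀ x)
    (hp : ∀ k, 1 ≤ k → k ≤ n → SingExpr.MemNegW b k (p k))
    (hq : ∀ k, k < n → SingExpr.MemNegW b k (q k)) :
    ∃ (K : ℝ → ℝ → ℂ) (a : ℝ → ℝ) (u : ℕ → ℝ → ℂ),
      -- the kernel: measurability, the bound, and the explicit formula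
      AEStronglyMeasurable (Function.uncurry K)
        ((volume : Measure (ℝ × ℝ)).restrict SingExpr.triangle) ∧
      SingExpr.MemWL2 (SingExpr.recip b) (fun x => (a x : ℂ)) ∧
      (∀ x t : ℝ, 0 < t → t < x → x < 1 → ‖K x t‖ ≤ a x + a t) ∧
      (∀ P Q : ℕ → ℝ → ℂ,
        (∀ k, 1 ≤ k → k ≤ n → SingExpr.IsAntideriv b k (P k) (p k)) →
        (∀ k, k < n → SingExpr.IsAntideriv b k (Q k) (q k)) →
        ∀ᵐ z ∂((volume : Measure (ℝ × ℝ)).restrict SingExpr.triangle),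
          K z.1 z.2 = SingExpr.kernel n P Q z.1 z.2) ∧
      -- the operator `B` is well defined on `L_{2,b}` and maps it bijectively onto `L_{2,1/b}`
      (∀ f, SingExpr.MemWL2 b f → ∀ᵐ x ∂SingExpr.mu,
        IntervalIntegrable (fun t => K x t * f t) volume 0 x) ∧
      SingExpr.BijectiveModAE (SingExpr.opB b K)
        (SingExpr.MemWL2 b) (SingExpr.MemWL2 (SingExpr.recip b)) ∧
      -- the functions in the finite-rank operator `C`
      (∀ ν, ν < n → SingExpr.MemWL2 (SingExpr.recip b) (u ν)) ∧
      -- the representation, as an equality of functionals on test functions of order `n`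
      (∀ y, SingExpr.MemW b n y → ∀ φ, SingExpr.MemW0 b n φ →
        SingExpr.ell n p₀ p q y φ =
          SingExpr.gDer n (SingExpr.reg (fun x =>
            SingExpr.opB b K (SingExpr.der n y) x + SingExpr.opC n u y x)) φ) := by
  have hw : SingExpr.GoodWeight b :=
    SingExpr.goodWeight_of_sq hp₀ hp₀_ne hp₀_inv hb_meas hb
  choose! P hP using hp
  choose! Q hQ using hq
  have hrep : ∀ {P Q : ℕ → ℝ → ℂ},
      (∀ k, 1 ≤ k → k ≤ n → SingExpr.IsAntideriv b k (P k) (p k)) →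
      (∀ k, k < n → SingExpr.IsAntideriv b k (Q k) (q k)) →
      SingExpr.Represents b n
        (fun y φ => SingExpr.lowerSum n P Q (fun σ i j => SingExpr.pairing n σ i j y φ))
        (SingExpr.kernel n P Q) := fun hP hQ =>
    SingExpr.represents_kernel hw (fun k h1 h2 => (hP k h1 h2).1) fun k hk => (hQ k hk).1
  have hK := hrep hP hQ
  obtain ⟨a, ha, hbound⟩ := hK.good.bound
  obtain ⟨u, hu, hy⟩ := hK.rep
  refine ⟨SingExpr.kernel n P Q, a, u, hK.good.aesm_triangle, ha, hbound, ?_,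
    fun f hf => hK.good.ae_intervalIntegrable hw hf, SingExpr.bijective_opB hw hK.good,
    fun ν _ => hu ν, ?_⟩
  -- Both choices describe the same ℓy, with the same leading integral and the same sign (-1)^n.
  -- Cancelling these shows that the lower-order functionals agree, and a functional has only one
  -- kernel.
  · intro P' Q' hP' hQ'
    refine hK.kernel_unique hw (hrep hP' hQ') fun y φ hy hφ => ?_
    have h := (SingExpr.ell_eq hw (p₀ := p₀) hP hQ hy hφ).symm.trans
      (SingExpr.ell_eq hw hP' hQ' hy hφ)
    exact add_left_cancel (mul_left_cancel₀ (pow_ne_zero n (by norm_num)) h)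
  · intro y hyW φ hφ
    rw [SingExpr.ell_eq hw hP hQ hyW hφ]
    exact SingExpr.ell_eq_gDer_opB hw hb hK.good hu hyW hφ (hy y φ hyW hφ)
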